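/- All multigraphs are finite and loopless, and $\mu_G(uv)$ denotes the number of edges of $G$ between distinct vertices $u$ and $v$. For a positive integer $m$, an $m$-star is a simple graph consisting of $m$ edges that join one vertex, the centre, to $m$ distinct other vertices (for $m=1$ one of the two vertices is designated as the centre); its size is $m$. A packing of $G$ with stars is a collection (multiset) of stars on vertices of $G$ such that any two distinct vertices $u,v$ are adjacent in at most $\mu_G(uv)$ of the stars, counted with multiplicity. For a multiset $M$ of positive integers and $i\in\{0,\ldots,|M|\}$, let $\sigma_i(M)$ be the sum of the $i$ largest elements of $M$. Theorem. Let $G$ be a loopless multigraph with vertex set $V$ and, for each $v\in V$, let $M_v$ be a (possibly empty) multiset of positive integers. There is a packing of $G$ with stars such that, for each $v\in V$, $M_v$ is the multiset of sizes of the stars centred at $v$, if and only if \[\sum_{v\in V}\sigma_{f(v)}(M_v)\leq\sum_{\{u,v\}\in\binom{V}{2}}\min\bigl(f(u)+f(v),\mu_G(uv)\bigr)\] for each function $f:V\to\mathbb{Z}$ such that $f(v)\in\{0,\ldots,|M_v|\}$ for each $v\in V$, where $\binom{V}{2}$ is the set of 2-element subsets of $V$. Furthermore, there is an algorithm that decides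 whether such a packing exists, and constructs one if so, in time polynomial in the size of the input. Here the input consists of the number $n$ of vertices, the $\binom n2$ multiplicities $\mu_G(uv)$ and, for each $v\in V$, the sequence of the elements of $M_v$, all numbers being written in binary; the algorithm runs on a random access machine with logarithmic cost (each elementary operation costs one plus the number of binary digits of the numbers and addresses it handles). -/

import Mathlib

namespace StarPacking

/-! ### Multigraphs, stars and packings -/

/-- A loopless multigraph with vertex set `V`: `mult u v` is the number of edges between
`u` and `v`. -/
@[ext]
structure Multigraph (V : Type*) where
  mult : V → V → ℕ
  symm : ∀ u v, mult u v = mult v u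
  loopless : ∀ v, mult v v = 0

namespace Multigraph

variable {V : Type*}

/-- `H` is a sub-multigraph of `G`. -/
def IsSub (H G : Multigraph V) : Prop :=
  ∀ u v, H.mult u v ≤ G.mult u v

/-- A decomposition of `G`: a collection (multiset) of sub-multigraphs whose multiplicities add up
to those of `G`. -/
def IsDecomposition (D : Multiset (Multigraph V)) (G : Multigraph V) : Prop :=
  (∀ H ∈ D, H.IsSub G) ∧
    ∀ u v, u ≠ v → (D.map fun H => H.mult u v).sum = G.mult u v

/-- A packing of `G`: a decomposition of some sub-multigraph of `G`. -/
def IsPacking (D : Multiset (Multigraph V)) (G : Multigraph V) : Prop :=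
  ∃ H : Multigraph V, H.IsSub G ∧ IsDecomposition D H

/-- The function `{u, v} ↦ min (f u + f v) (μ_G(uv))` on unordered pairs. -/
def cappedMult (G : Multigraph V) (f : V → ℕ) : Sym2 V → ℕ :=
  Sym2.lift ⟨fun u v => min (f u + f v) (G.mult u v), fun u v => by
    simp only [add_comm (f u) (f v), G.symm u v]⟩

end Multigraph

/-- A star with vertices in `V` together with its (designated) centre: its edges join the centre
to each of the leaves. -/
structure CentredStar (V : Type*) where
  centre : V
  leaves : Finset V
  nonempty : leaves.Nonempty
  centre_notMem : centre ∉ leaves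

namespace CentredStar

variable {V : Type*}

/-- The number of edges of the star. -/
def size (S : CentredStar V) : ℕ := S.leaves.card

/-- The star as a (simple) multigraph. -/
def toMultigraph [DecidableEq V] (S : CentredStar V) : Multigraph V where
  mult u v := if (u = S.centre ∧ v ∈ S.leaves) ∨ (v = S.centre ∧ u ∈ S.leaves) then 1 else 0
  symm u v := by simp only [or_comm]
  loopless v := by
    have h := S.centre_notMem
    rw [if_neg]
    rintro (⟨rfl, hv⟩ | ⟨rfl, hv⟩) <;> exact h hv

end CentredStar

/-- The collection `P` of stars is a packing of `G` in which, for each vertex `v`, `M v` is the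
multiset of sizes of the stars centred at `v`. -/
def IsStarPacking {V : Type*} [DecidableEq V] (G : Multigraph V) (M : V → Multiset ℕ)
    (P : Multiset (CentredStar V)) : Prop :=
  Multigraph.IsPacking (P.map CentredStar.toMultigraph) G ∧
    ∀ v, (P.filter fun S => S.centre = v).map CentredStar.size = M v

/-- `σ_i(M)`: the sum of the `i` largest elements of `M`. -/
def sigma (i : ℕ) (M : Multiset ℕ) : ℕ :=
  ((M.sort (· ≥ ·)).take i).sum

/-! ### Random access machines with logarithmic cost -/

/-- The arithmetic operations of the machine. -/
inductive ArithOp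
  | add | sub | mul | div

/-- Subtraction is truncated at `0`, division is rounded down. -/
def ArithOp.eval : ArithOp → ℕ → ℕ → ℕ
  | add, a, b => a + b
  | sub, a, b => a - b
  | mul, a, b => a * b
  | div, a, b => a / b

/-- Programs of a random access machine, in structured form. The machine has registers holding
natural numbers, arrays of natural numbers (of which a program uses finitely many), and an output
tape. -/
inductive Program
  /-- do nothing -/
  | skip
  /-- register `x` := the constant `c` -/
  | const (x c : ℕ)
  /-- register `x` := register `y` -/
  | copy (x y : ℕ)
  /-- register `x` := register `y` `op` register `z` -/
  | arith (op : ArithOp) (x y z : ℕ)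
  /-- register `x` := entry of array `a` at the index held in register `y` -/
  | load (x a y : ℕ)
  /-- entry of array `a` at the index held in register `y` := register `x` -/
  | store (a y x : ℕ)
  /-- append register `x` to the output -/
  | write (x : ℕ)
  /-- first `p`, then `q` -/
  | seq (p q : Program)
  /-- `p` if register `x` is nonzero, otherwise `q` -/
  | cond (x : ℕ) (p q : Program)
  /-- repeat `p` as long as register `x` is nonzero -/
  | loop (x : ℕ) (p : Program)

/-- A memory state: contents of the registers, contents of the arrays, output written so far. -/
structure State where
  reg : ℕ → ℕ
  mem : ℕ → ℕ → ℕ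
  out : List ℕ

namespace State

/-- Overwrite register `x` by the value `c`. -/
def setReg (s : State) (x c : ℕ) : State :=
  { s with reg := Function.update s.reg x c }

/-- Overwrite entry `i` of array `a` by the value `c`. -/
def setMem (s : State) (a i c : ℕ) : State :=
  { s with mem := Function.update s.mem a (Function.update (s.mem a) i c) }

/-- The state in which the machine starts on the input `w`: register `0` holds the length of `w`,
array `0` holds the entries of `w`, everything else is zero, and nothing has been output. -/
def init (w : List ℕ) : State where
  reg x := if x = 0 then w.length else 0
  mem a i := if a = 0 then w.getD i 0 else 0
  out := []

end State

/-- `Exec p s t s'`: started in state `s`, the program `p` halts in state `s'` after time `t`.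
Each elementary step costs one plus the number of binary digits of all numbers (addresses
included) that it handles. -/
inductive Exec : Program → State → ℕ → State → Prop
  | skip (s : State) : Exec .skip s 1 s
  | const (s : State) (x c : ℕ) :
      Exec (.const x c) s (1 + c.size) (s.setReg x c)
  | copy (s : State) (x y : ℕ) :
      Exec (.copy x y) s (1 + (s.reg y).size) (s.setReg x (s.reg y))
  | arith (s : State) (op : ArithOp) (x y z : ℕ) :
      Exec (.arith op x y z) s
        (1 + (s.reg y).size + (s.reg z).size + (op.eval (s.reg y) (s.reg z)).size)
        (s.setReg x (op.eval (s.reg y) (s.reg z)))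
  | load (s : State) (x a y : ℕ) :
      Exec (.load x a y) s (1 + (s.reg y).size + (s.mem a (s.reg y)).size)
        (s.setReg x (s.mem a (s.reg y)))
  | store (s : State) (a y x : ℕ) :
      Exec (.store a y x) s (1 + (s.reg y).size + (s.reg x).size)
        (s.setMem a (s.reg y) (s.reg x))
  | write (s : State) (x : ℕ) :
      Exec (.write x) s (1 + (s.reg x).size) { s with out := s.out ++ [s.reg x] }
  | seq {p q : Program} {s s' s'' : State} {t t' : ℕ} :
      Exec p s t s' → Exec q s' t' s'' → Exec (.seq p q) s (t + t') s''
  | cond_pos {x : ℕ} {p q : Program} {s s' : State} {t : ℕ} :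
      s.reg x ≠ 0 → Exec p s t s' → Exec (.cond x p q) s (1 + (s.reg x).size + t) s'
  | cond_zero {x : ℕ} {p q : Program} {s s' : State} {t : ℕ} :
      s.reg x = 0 → Exec q s t s' → Exec (.cond x p q) s (1 + (s.reg x).size + t) s'
  | loop_pos {x : ℕ} {p : Program} {s s' s'' : State} {t t' : ℕ} :
      s.reg x ≠ 0 → Exec p s t s' → Exec (.loop x p) s' t' s'' →
        Exec (.loop x p) s (1 + (s.reg x).size + t + t') s''
  | loop_zero {x : ℕ} {p : Program} {s : State} :
      s.reg x = 0 → Exec (.loop x p) s (1 + (s.reg x).size) s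

/-- The size of a sequence of natural numbers written in binary (each entry followed by a
separator). -/
def binarySize (w : List ℕ) : ℕ :=
  (w.map fun a => a.size + 1).sum

/-! ### The computational problem -/

/-- An instance of the star packing problem: a multigraph with vertices `0, …, n - 1` and for each
vertex a sequence of positive star sizes. -/
structure Instance where
  n : ℕ
  graph : Multigraph (Fin n)
  sizes : Fin n → List ℕ
  pos : ∀ v, ∀ m ∈ sizes v, 0 < m

namespace Instance

/-- The prescribed multisets of star sizes. -/
def starSizes (I : Instance) (v : Fin I.n) : Multiset ℕ := (I.sizes v : Multiset ℕ)

/-- An instance as a sequence of natural numbers: `n`, then the `n.choose 2` multiplicities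
`μ_G(uv)` for `u < v`, then for each vertex the number of its star sizes followed by these
sizes. -/
def encode (I : Instance) : List ℕ :=
  I.n ::
    (((List.finRange I.n).flatMap fun u =>
        ((List.finRange I.n).filter fun v => u < v).map fun v => I.graph.mult u v) ++
      (List.finRange I.n).flatMap fun v => (I.sizes v).length :: I.sizes v)

end Instance

/-- A list of stars as a sequence of natural numbers: the number of stars, then for each star its
centre, the number of its leaves, and its leaves in increasing order. -/
def encodeStars {n : ℕ} (P : List (CentredStar (Fin n))) : List ℕ :=
  P.length ::
    P.flatMap fun S =>
      (S.centre : ℕ) :: S.size :: (S.leaves.sort (· ≤ ·)).map fun v => (v : ℕ)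

end StarPacking

/-!
# Packing a multigraph with stars of prescribed sizes

A packing with prescribed stars is a solution of a transportation problem: every star `s` of size
`m` needs `m` distinct pairs of vertices among those containing its centre, and a pair `e` can serve
at most `μ(e)` stars. The condition of the theorem is the cut condition of this problem: among all
choices of `f v` stars at each vertex `v`, the largest stars demand most.

*Necessity* is a count (`IsStarPacking.sum_sigma_le`): the `f v` largest stars at each `v` have
`∑ v, σ_{f v}(M v)` edges together, at most `min (f u + f v) (μ(uv))` of them on the pair `uv`.

*Sufficiency and the algorithm* rest on one push-relabel scheme. A partial assignment carries
heights on the stars. A star `s` that lacks a pair may take an unused unit of a pair at its centre,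
or steal a unit from a lower star, and it is lifted by one when neither is possible. Along each
residual arc the height drops by at most one (`Flow.Step.valid`). Each move raises the potential,
in which each unit in use counts the height of its user plus one and the heights are added on top
(`Flow.Step.potential_lt`); as heights are capped by some `H`, the potential stays bounded by a
polynomial (`Flow.Valid.potential_le`) and the moves come to an end. If then some star still lacks
a pair, it has height `H`. For `H` at least the number of stars, some level below it is empty, and
the stars above that level saturate all the pairs they could use, which violates the cut condition
(`Flow.exists_obstruction`). `IsEncoding` translates between this problem and star packings.

*Polynomial time.* The algorithm is written in a small language whose loops all run through
`0, …, ℓ - 1`, where `ℓ` is the length of the input list. Its translation to the machine thus takes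
a number of steps bounded by a polynomial in `ℓ` that can be read off from the text (`Cmd.cost`).
There is no multiplication, so each step lengthens the numbers by at most one binary digit, and a
polynomial number of steps has polynomial logarithmic cost (`Runs`, `Cmd.exists_exec_compile`). The
algorithm reads the input, makes `4 * ℓ ^ 3` sweeps over the stars, each of which raises the
potential unless nothing is left to do (`Algorithm.sweeps_run`), and prints the stars.
-/

namespace StarPacking

/-! ### A push-relabel scheme for unit-capacity transportation -/

/-- A partial assignment in the transportation problem: `X s e` is `1` if `s` uses `e` and `0`
otherwise, `R e` is the number of units of `e` not in use, `d s` is the number of units that `s`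
still lacks, and `h s` is the height of `s`. -/
@[ext]
structure Flow (ι ε : Type*) where
  X : ι → ε → ℕ
  R : ε → ℕ
  d : ι → ℕ
  h : ι → ℕ

/-- Exactly one summand is replaced. -/
theorem sum_replace {ι : Type*} [DecidableEq ι] {S : Finset ι} {s : ι} (hs : s ∈ S) (f : ι → ℕ)
    (v : ℕ) : ∑ a ∈ S, (if a = s then v else f a) + f s = ∑ a ∈ S, f a + v := by
  rw [← Finset.add_sum_erase S _ hs, ← Finset.add_sum_erase S f hs, if_pos rfl,
    Finset.sum_congr rfl fun a ha => if_neg (Finset.ne_of_mem_erase ha)]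
  ring

namespace Flow

variable {ι ε : Type*}

/-- The number of elements of `E` that `s` uses. -/
def deg (E : Finset ε) (a : Flow ι ε) (s : ι) : ℕ := ∑ e ∈ E, a.X s e

/-- The assignment respects the incidence relation `inc`, the demands `m` and the capacities `cap`,
and the heights form a valid labelling bounded by `H`: along every residual arc the height drops
by at most one, the elements with unused capacity being at height `-1`. -/
structure Valid (S : Finset ι) (E : Finset ε) (inc : ι → ε → Prop) (m : ι → ℕ) (cap : ε → ℕ)
    (H : ℕ) (a : Flow ι ε) : Prop where
  zero_or_one : ∀ s e, a.X s e = 0 ∨ a.X s e = 1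
  inc_of_X : ∀ s ∈ S, ∀ e ∈ E, a.X s e ≠ 0 → inc s e
  demand : ∀ s ∈ S, a.d s + a.deg E s = m s
  capacity : ∀ e ∈ E, a.R e + ∑ s ∈ S, a.X s e = cap e
  slack : ∀ s ∈ S, ∀ e ∈ E, inc s e → a.X s e = 0 → 0 < a.R e → a.h s = 0
  users : ∀ s ∈ S, ∀ t ∈ S, ∀ e ∈ E, inc s e → a.X s e = 0 → a.X t e ≠ 0 → a.h s ≤ a.h t + 1
  height_le : ∀ s ∈ S, a.h s ≤ H

variable [DecidableEq ι] [DecidableEq ε]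

/-- `s` takes an unused unit of `e`. -/
def take (a : Flow ι ε) (s : ι) (e : ε) : Flow ι ε where
  X i j := if i = s ∧ j = e then 1 else a.X i j
  R j := if j = e then a.R e - 1 else a.R j
  d i := if i = s then a.d s - 1 else a.d i
  h := a.h

/-- `s` takes over from `t` the unit of `e` that `t` uses. -/
def steal (a : Flow ι ε) (s t : ι) (e : ε) : Flow ι ε where
  X i j := if i = t ∧ j = e then 0 else if i = s ∧ j = e then 1 else a.X i j
  R := a.R
  d i := if i = t then a.d t + 1 else if i = s then a.d s - 1 else a.d i
  h := a.h

/-- `s` is lifted by one. -/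
def relabel (a : Flow ι ε) (s : ι) : Flow ι ε where
  X := a.X
  R := a.R
  d := a.d
  h i := if i = s then a.h s + 1 else a.h i

/-- `s` can be lifted: no elementary move of `s` along an element it does not use is possible. -/
def Blocked (S : Finset ι) (E : Finset ε) (inc : ι → ε → Prop) (a : Flow ι ε) (s : ι) : Prop :=
  ∀ e ∈ E, inc s e → a.X s e = 0 → a.R e = 0 ∧ ∀ t ∈ S, a.X t e ≠ 0 → a.h s ≤ a.h t

/-- The elementary moves. -/
inductive Step (S : Finset ι) (E : Finset ε) (inc : ι → ε → Prop) (H : ℕ) (a : Flow ι ε) :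
    Flow ι ε → Prop
  | take (s : ι) (e : ε) : s ∈ S → e ∈ E → inc s e → 0 < a.d s → a.X s e = 0 → 0 < a.R e →
      Step S E inc H a (a.take s e)
  | steal (s t : ι) (e : ε) : s ∈ S → t ∈ S → e ∈ E → inc s e → 0 < a.d s → a.X s e = 0 →
      a.X t e ≠ 0 → a.h t < a.h s → Step S E inc H a (a.steal s t e)
  | relabel (s : ι) : s ∈ S → 0 < a.d s → a.h s < H → Blocked S E inc a s →
      Step S E inc H a (a.relabel s)

/-- The potential: every unit in use counts the height of its user plus one, and the heights are
added on top. -/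
def potential (S : Finset ι) (E : Finset ε) (a : Flow ι ε) : ℕ :=
  ∑ s ∈ S, (a.deg E s * (a.h s + 1) + a.h s)

variable {S : Finset ι} {E : Finset ε} {inc : ι → ε → Prop} {m : ι → ℕ} {cap : ε → ℕ} {H : ℕ}
  {a b : Flow ι ε}

omit [DecidableEq ι] [DecidableEq ε] in
theorem Valid.deg_le (hv : Valid S E inc m cap H a) (s : ι) : a.deg E s ≤ E.card := by
  unfold deg
  rw [Finset.card_eq_sum_ones]
  refine Finset.sum_le_sum fun e _ => ?_
  rcases hv.zero_or_one s e with h | h <;> omega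

omit [DecidableEq ι] [DecidableEq ε] in
theorem Valid.potential_le (hv : Valid S E inc m cap H a) :
    a.potential S E ≤ S.card * (E.card * (H + 1) + H) := by
  unfold potential
  rw [← smul_eq_mul, ← Finset.sum_const]
  refine Finset.sum_le_sum fun s hs => ?_
  have h1 := hv.deg_le s
  have h2 := hv.height_le s hs
  gcongr

theorem deg_take {s : ι} {e : ε} (he : e ∈ E) (hX : a.X s e = 0) (i : ι) :
    (a.take s e).deg E i = if i = s then a.deg E s + 1 else a.deg E i := by
  unfold deg take
  split_ifs with h
  · subst h
    have := sum_replace he (a.X i) 1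
    simpa [hX] using this
  · simp [h]

theorem deg_steal {s t : ι} {e : ε} (he : e ∈ E) (hX : a.X s e = 0) (hY : a.X t e = 1) (i : ι) :
    (a.steal s t e).deg E i =
      if i = t then a.deg E t - 1 else if i = s then a.deg E s + 1 else a.deg E i := by
  have hst : s ≠ t := by rintro rfl; omega
  unfold deg steal
  split_ifs with h h'
  · subst h
    have := sum_replace he (a.X i) 0
    simp only [hY] at this
    simp only [true_and, hst.symm, false_and, if_false]
    omega
  · subst h'
    have := sum_replace he (a.X i) 1
    simpa [hX, h] using this
  · simp [h, h']

theorem Step.potential_lt (hv : Valid S E inc m cap H a) (hs : Step S E inc H a b) :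
    a.potential S E < b.potential S E := by
  unfold potential
  cases hs with
  | take s e hs he hi hd hX hR =>
    apply Finset.sum_lt_sum
    · intro i _
      rw [deg_take he hX]
      split_ifs with h
      · subst h
        simp only [Flow.take]
        nlinarith
      · rfl
    · refine ⟨s, hs, ?_⟩
      rw [deg_take he hX]
      simp only [if_true, Flow.take]
      nlinarith
  | steal s t e hs ht he hi hd hX hY hh =>
    have hY1 : a.X t e = 1 := (hv.zero_or_one t e).resolve_left hY
    have hst : s ≠ t := by rintro rfl; omega
    have hst' : s ∈ S.erase t := Finset.mem_erase.2 ⟨hst, hs⟩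
    have hdt : 1 ≤ a.deg E t := by
      unfold deg
      rw [← hY1]
      exact Finset.single_le_sum (f := a.X t) (fun _ _ => Nat.zero_le _) he
    rw [← Finset.add_sum_erase S _ ht, ← Finset.add_sum_erase _ _ hst',
      ← Finset.add_sum_erase S _ ht, ← Finset.add_sum_erase _ _ hst']
    have hrest : ∑ x ∈ (S.erase t).erase s,
        ((a.steal s t e).deg E x * ((a.steal s t e).h x + 1) + (a.steal s t e).h x) =
        ∑ x ∈ (S.erase t).erase s, (a.deg E x * (a.h x + 1) + a.h x) := by
      refine Finset.sum_congr rfl fun x hx => ?_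
      have h1 := Finset.ne_of_mem_erase hx
      have h2 := Finset.ne_of_mem_erase (Finset.mem_of_mem_erase hx)
      rw [deg_steal he hX hY1, if_neg h2, if_neg h1]
      rfl
    rw [hrest, deg_steal he hX hY1, deg_steal he hX hY1, if_pos rfl, if_neg hst, if_pos rfl]
    simp only [Flow.steal]
    obtain ⟨k, hk⟩ := Nat.exists_eq_add_of_le hdt
    rw [hk, Nat.add_sub_cancel_left]
    nlinarith
  | relabel s hs hd hh hB =>
    have hdeg : ∀ i, (a.relabel s).deg E i = a.deg E i := fun i => rfl
    apply Finset.sum_lt_sum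
    · intro i _
      rw [hdeg]
      simp only [Flow.relabel]
      split_ifs with h
      · subst h
        nlinarith
      · rfl
    · refine ⟨s, hs, ?_⟩
      rw [hdeg]
      simp only [Flow.relabel, if_true]
      nlinarith

theorem Step.valid (hv : Valid S E inc m cap H a) (hs : Step S E inc H a b) :
    Valid S E inc m cap H b := by
  cases hs with
  | take s e hs he hi hd hX hR =>
    refine ⟨?_, ?_, ?_, ?_, ?_, ?_, hv.height_le⟩
    · intro i j
      simp only [Flow.take]
      split_ifs
      · exact Or.inr rfl
      · exact hv.zero_or_one i j
    · intro i hiS j hj hij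
      simp only [Flow.take] at hij
      split_ifs at hij with h
      · rw [h.1, h.2]; exact hi
      · exact hv.inc_of_X i hiS j hj hij
    · intro i hiS
      rw [deg_take he hX]
      have := hv.demand i hiS
      simp only [Flow.take]
      split_ifs with h
      · subst h; omega
      · exact this
    · intro j hj
      have := hv.capacity j hj
      simp only [Flow.take]
      split_ifs with h
      · subst h
        have h2 := sum_replace hs (fun i => a.X i j) 1
        simp only [and_true]
        simp only [hX] at h2
        omega
      · simpa [h] using this
    · intro i hiS j hj hinc hij hRj
      simp only [Flow.take] at hij hRj ⊢
      split_ifs at hij with h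
      refine hv.slack i hiS j hj hinc hij ?_
      split_ifs at hRj with h'
      · subst h'; exact hR
      · exact hRj
    · intro i hiS k hk j hj hinc hij hkj
      simp only [Flow.take] at hij hkj ⊢
      split_ifs at hij with h
      split_ifs at hkj with h'
      · have : a.h i = 0 := hv.slack i hiS j hj hinc hij (by rw [h'.2]; exact hR)
        omega
      · exact hv.users i hiS k hk j hj hinc hij hkj
  | steal s t e hs ht he hi hd hX hY hh =>
    have hY1 : a.X t e = 1 := (hv.zero_or_one t e).resolve_left hY
    have hst : s ≠ t := by rintro rfl; omega
    have hst1 := hv.users s hs t ht e he hi hX hY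
    have hdt : 1 ≤ a.deg E t := by
      unfold deg
      rw [← hY1]
      exact Finset.single_le_sum (f := a.X t) (fun _ _ => Nat.zero_le _) he
    refine ⟨?_, ?_, ?_, ?_, ?_, ?_, hv.height_le⟩
    · intro i j
      simp only [Flow.steal]
      split_ifs
      · exact Or.inl rfl
      · exact Or.inr rfl
      · exact hv.zero_or_one i j
    · intro i hiS j hj hij
      simp only [Flow.steal] at hij
      split_ifs at hij with h h'
      · exact absurd rfl hij
      · rw [h'.1, h'.2]; exact hi
      · exact hv.inc_of_X i hiS j hj hij
    · intro i hiS
      rw [deg_steal he hX hY1]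
      have := hv.demand i hiS
      simp only [Flow.steal]
      split_ifs with h h'
      · subst h; omega
      · subst h'; omega
      · exact this
    · intro j hj
      have := hv.capacity j hj
      simp only [Flow.steal]
      by_cases h : j = e
      · subst h
        have h1 := sum_replace hs (fun i => a.X i j) 1
        have h2 := sum_replace ht (fun i => if i = s then 1 else a.X i j) 0
        simp only [and_true]
        simp only [hX, if_neg hst.symm, hY1] at h1 h2
        omega
      · simpa [h] using this
    · intro i hiS j hj hinc hij hRj
      simp only [Flow.steal] at hij hRj ⊢
      split_ifs at hij with h h'
      · rw [h.2] at hRj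
        have := hv.slack s hs e he hi hX hRj
        omega
      · exact hv.slack i hiS j hj hinc hij hRj
    · intro i hiS k hk j hj hinc hij hkj
      simp only [Flow.steal] at hij hkj ⊢
      split_ifs at hkj with h1 h2
      · exact absurd rfl hkj
      · -- the new user `s` of `e` is higher than the old user `t`
        rw [h2.1]
        rw [h2.2] at hij hinc
        split_ifs at hij with h3 h4
        · rw [h3.1]; omega
        · have := hv.users i hiS t ht e he hinc hij hY
          omega
      · split_ifs at hij with h3 h4
        · -- `t` does not use `e` any more, but `s` was only one higher
          rw [h3.2] at hkj
          have := hv.users s hs k hk e he hi hX hkj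
          rw [h3.1]; omega
        · exact hv.users i hiS k hk j hj hinc hij hkj
  | relabel s hs hd hh hB =>
    refine ⟨hv.zero_or_one, hv.inc_of_X, hv.demand, hv.capacity, ?_, ?_, ?_⟩
    · intro i hiS j hj hinc hij hRj
      simp only [Flow.relabel] at hij hRj ⊢
      split_ifs with h
      · subst h
        have := (hB j hj hinc hij).1
        omega
      · exact hv.slack i hiS j hj hinc hij hRj
    · intro i hiS k hk j hj hinc hij hkj
      have h0 := hv.users i hiS k hk j hj hinc hij hkj
      simp only [Flow.relabel] at hij hkj ⊢
      split_ifs with h h' h'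
      · omega
      · subst h
        have := (hB j hj hinc hij).2 k hk hkj
        omega
      · subst h'; omega
      · exact h0
    · intro i hiS
      have := hv.height_le i hiS
      simp only [Flow.relabel]
      split_ifs with h
      · exact hh
      · exact this

/-- If no move is possible, everything that still lacks a unit has the maximal height. -/
theorem height_of_stuck (hst : ∀ b, ¬ Step S E inc H a b) :
    ∀ s ∈ S, 0 < a.d s → H ≤ a.h s := by
  intro s hs hd
  by_contra! hh
  refine hst _ (Step.relabel s hs hd hh fun e he hi hX => ⟨?_, fun t ht hY => ?_⟩)
  · by_contra hR
    exact hst _ (Step.take s e hs he hi hd hX (Nat.pos_of_ne_zero hR))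
  · by_contra! hlt
    exact hst _ (Step.steal s t e hs ht he hi hd hX hY hlt)

omit [DecidableEq ε] in
/-- Some level below a vertex of height at least `#S` is empty, and the vertices above it form an
obstruction: they saturate everything they could use. -/
theorem exists_obstruction (hv : Valid S E inc m cap H a) {s₀ : ι} (hs₀ : s₀ ∈ S)
    (hd : 0 < a.d s₀) (hh : S.card ≤ a.h s₀) [∀ s e, Decidable (inc s e)] :
    ∃ A ⊆ S, ∑ e ∈ E, min (cap e) (A.filter fun s => inc s e).card < ∑ s ∈ A, m s := by
  obtain ⟨k, hk, hk'⟩ : ∃ k ∈ Finset.range S.card, k ∉ (S.erase s₀).image a.h := by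
    by_contra! hcon
    have h1 := Finset.card_le_card (show Finset.range S.card ⊆ (S.erase s₀).image a.h from hcon)
    have h2 := Finset.card_image_le (s := S.erase s₀) (f := a.h)
    have h3 := Finset.card_erase_lt_of_mem hs₀
    rw [Finset.card_range] at h1
    omega
  rw [Finset.mem_range] at hk
  have hne : ∀ s ∈ S, a.h s ≠ k := by
    intro s hs h
    by_cases hss : s = s₀
    · subst hss; omega
    · exact hk' (Finset.mem_image.2 ⟨s, Finset.mem_erase.2 ⟨hss, hs⟩, h⟩)
  set A := S.filter fun s => k < a.h s with hA
  have hAS : A ⊆ S := Finset.filter_subset _ _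
  have hsA : s₀ ∈ A := Finset.mem_filter.2 ⟨hs₀, by omega⟩
  refine ⟨A, hAS, ?_⟩
  have hle : ∀ e ∈ E, min (cap e) (A.filter fun s => inc s e).card ≤ ∑ s ∈ A, a.X s e := by
    intro e he
    by_cases hall : ∀ s ∈ A, inc s e → a.X s e ≠ 0
    · refine (min_le_right _ _).trans ?_
      rw [Finset.card_filter]
      refine Finset.sum_le_sum fun s hs => ?_
      split_ifs with h
      · exact Nat.one_le_iff_ne_zero.2 (hall s hs h)
      · exact Nat.zero_le _
    · -- some vertex above the gap does not use `e`, so `e` is full and all its users are above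
      push Not at hall
      obtain ⟨s, hs, hi, hX⟩ := hall
      obtain ⟨hsS, hsk⟩ := Finset.mem_filter.1 hs
      refine (min_le_left _ _).trans ?_
      have hR : a.R e = 0 := by
        by_contra hR
        have := hv.slack s hsS e he hi hX (Nat.pos_of_ne_zero hR)
        omega
      rw [← hv.capacity e he, hR, zero_add]
      refine (Finset.sum_subset hAS fun t ht htA => ?_).ge
      by_contra hY
      have h1 := hv.users s hsS t ht e he hi hX hY
      have h2 := hne t ht
      exact htA (Finset.mem_filter.2 ⟨ht, by omega⟩)
  calc ∑ e ∈ E, min (cap e) (A.filter fun s => inc s e).card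
      ≤ ∑ e ∈ E, ∑ s ∈ A, a.X s e := Finset.sum_le_sum hle
    _ = ∑ s ∈ A, a.deg E s := Finset.sum_comm
    _ < ∑ s ∈ A, m s := by
      refine Finset.sum_lt_sum (fun s hs => ?_) ⟨s₀, hsA, ?_⟩
      · have := hv.demand s (hAS hs); omega
      · have := hv.demand s₀ hs₀; omega

/-- The empty assignment. -/
def empty (m : ι → ℕ) (cap : ε → ℕ) : Flow ι ε where
  X _ _ := 0
  R := cap
  d := m
  h _ := 0

omit [DecidableEq ι] [DecidableEq ε] in
theorem valid_empty : Valid S E inc m cap H (empty m cap) where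
  zero_or_one _ _ := Or.inl rfl
  inc_of_X _ _ _ _ h := absurd rfl h
  demand s _ := by simp [empty, deg]
  capacity e _ := by simp [empty]
  slack _ _ _ _ _ _ _ := rfl
  users _ _ _ _ _ _ _ _ _ := Nat.zero_le _
  height_le _ _ := Nat.zero_le _

theorem Valid.exists_stuck (hv : Valid S E inc m cap H a) :
    ∃ b, Valid S E inc m cap H b ∧ ∀ c, ¬ Step S E inc H b c := by
  obtain ⟨k, hk⟩ : ∃ k, S.card * (E.card * (H + 1) + H) - a.potential S E = k := ⟨_, rfl⟩
  induction k using Nat.strong_induction_on generalizing a with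
  | _ k ih =>
    by_cases hst : ∃ c, Step S E inc H a c
    · obtain ⟨c, hc⟩ := hst
      have h1 := hc.potential_lt hv
      have h2 := (hc.valid hv).potential_le
      exact ih _ (by omega) (hc.valid hv) rfl
    · exact ⟨a, hv, by simpa using hst⟩

end Flow

/-! ### Sums of largest elements -/

theorem sum_le_sum_take_of_le {l : List ℕ} (hl : l.Pairwise (· ≥ ·)) {T : Multiset ℕ}
    (hT : T ≤ (l : Multiset ℕ)) : T.sum ≤ (l.take T.card).sum := by
  induction l generalizing T with
  | nil => simp [Multiset.le_zero.1 hT]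
  | cons a l ih =>
    obtain ⟨ha, hl⟩ := List.pairwise_cons.1 hl
    rw [← Multiset.cons_coe] at hT
    rcases Multiset.empty_or_exists_mem T with rfl | ⟨b, hb⟩
    · simp
    by_cases haT : a ∈ T
    · obtain ⟨T, rfl⟩ := Multiset.exists_cons_of_mem haT
      have := ih hl ((Multiset.cons_le_cons_iff a).1 hT)
      simpa using this
    · have hTl : T ≤ (l : Multiset ℕ) := (Multiset.le_cons_of_notMem haT).1 hT
      have hba : b ≤ a := ha b (by simpa using Multiset.mem_of_le hTl hb)
      obtain ⟨T, rfl⟩ := Multiset.exists_cons_of_mem hb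
      have := ih hl ((Multiset.le_cons_self _ _).trans hTl)
      simp only [Multiset.sum_cons, Multiset.card_cons, List.take_succ_cons, List.sum_cons]
      omega

theorem sum_le_sigma {T M : Multiset ℕ} (hT : T ≤ M) : T.sum ≤ sigma T.card M :=
  sum_le_sum_take_of_le (Multiset.pairwise_sort M _) (by rwa [Multiset.sort_eq])

theorem exists_sum_eq_sigma {M : Multiset ℕ} {i : ℕ} (hi : i ≤ M.card) :
    ∃ T ∈ M.powersetCard i, T.sum = sigma i M := by
  refine ⟨((M.sort (· ≥ ·)).take i : List ℕ), ?_, by simp [sigma]⟩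
  rw [Multiset.mem_powersetCard]
  constructor
  · conv_rhs => rw [← Multiset.sort_eq M (· ≥ ·)]
    exact (List.take_sublist _ _).subperm
  · simpa using hi

/-! ### Packings with stars -/

section Packing

variable {V : Type*} [DecidableEq V]

theorem sum_mult_self (P : Multiset (CentredStar V)) (v : V) :
    ((P.map CentredStar.toMultigraph).map fun H => H.mult v v).sum = 0 := by
  refine Multiset.sum_eq_zero fun x hx => ?_
  obtain ⟨H, -, rfl⟩ := Multiset.mem_map.1 hx
  exact H.loopless v

theorem isPacking_map_toMultigraph_iff {P : Multiset (CentredStar V)} {G : Multigraph V} :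
    Multigraph.IsPacking (P.map CentredStar.toMultigraph) G ↔
      ∀ u v, u ≠ v → (P.map fun S => S.toMultigraph.mult u v).sum ≤ G.mult u v := by
  constructor
  · rintro ⟨H, hHG, -, hsum⟩ u v huv
    have := hsum u v huv
    rw [Multiset.map_map] at this
    exact this.le.trans (hHG u v)
  · intro h
    refine ⟨⟨fun u v => ((P.map CentredStar.toMultigraph).map fun H => H.mult u v).sum,
      fun u v => ?_, sum_mult_self P⟩, fun u v => ?_, fun H hH u v => ?_, fun u v _ => rfl⟩
    · simp only [fun H : Multigraph V => H.symm u v]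
    · by_cases huv : u = v
      · subst huv
        exact (sum_mult_self P u).trans_le (Nat.zero_le _)
      · simpa using h u v huv
    · exact Multiset.single_le_sum (fun _ _ => Nat.zero_le _) _
        (Multiset.mem_map_of_mem (fun H : Multigraph V => H.mult u v) hH)

theorem card_filter_eq_sum_map {α : Type*} (p : α → Prop) [DecidablePred p] (s : Multiset α) :
    (s.filter p).card = (s.map fun a => if p a then 1 else 0).sum := by
  induction s using Multiset.induction_on with
  | empty => rfl
  | cons a s ih => by_cases h : p a <;> simp [h, ih, add_comm]

theorem CentredStar.mult_eq (S : CentredStar V) {u v : V} :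
    S.toMultigraph.mult u v = (if S.centre = u ∧ v ∈ S.leaves then 1 else 0) +
      if S.centre = v ∧ u ∈ S.leaves then 1 else 0 := by
  have h := S.centre_notMem
  simp only [toMultigraph, @eq_comm _ u, @eq_comm _ v]
  by_cases h1 : S.centre = u ∧ v ∈ S.leaves
  · rw [if_pos (Or.inl h1), if_pos h1, if_neg]
    rintro ⟨-, hu⟩
    exact h (h1.1 ▸ hu)
  · by_cases h2 : S.centre = v ∧ u ∈ S.leaves
    · rw [if_pos (Or.inr h2), if_neg h1, if_pos h2]
    · rw [if_neg (not_or.2 ⟨h1, h2⟩), if_neg h1, if_neg h2]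

variable [Fintype V]

/-- A sum over ordered pairs, collected by unordered pairs. -/
theorem sum_sum_le_sum_sym2 {q : V → V → ℕ} {F : Sym2 V → ℕ} (hq : ∀ v, q v v = 0)
    (hF : ∀ u v, u ≠ v → q u v + q v u ≤ F s(u, v)) :
    ∑ u, ∑ v, q u v ≤ ∑ e : Sym2 V with ¬ e.IsDiag, F e := by
  rw [← Finset.sum_product', Finset.univ_product_univ,
    ← Finset.sum_fiberwise Finset.univ (fun p : V × V => s(p.1, p.2)), Finset.sum_filter]
  refine Finset.sum_le_sum fun e _ => ?_
  induction e using Sym2.ind with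
  | _ u v =>
    by_cases huv : u = v
    · subst huv
      rw [if_neg (by simp)]
      refine (Finset.sum_eq_zero fun p hp => ?_).le
      obtain ⟨a, b⟩ := p
      have : a = u ∧ b = u := by simpa using hp
      rw [this.1, this.2]
      exact hq u
    · rw [if_pos (by simpa using huv)]
      have hfib : (Finset.univ.filter fun p : V × V => s(p.1, p.2) = s(u, v)) =
          {(u, v), (v, u)} := by
        ext ⟨a, b⟩
        simp
      rw [hfib, Finset.sum_pair (by simpa using fun h => absurd h huv)]
      exact hF u v huv

theorem sum_map_size_eq (Q : Multiset (CentredStar V)) :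
    (Q.map CentredStar.size).sum = ∑ w, (Q.map fun S => if w ∈ S.leaves then 1 else 0).sum := by
  induction Q using Multiset.induction_on with
  | empty => simp
  | cons S Q ih => simp [Finset.sum_add_distrib, ih, CentredStar.size]

/-- Necessity of the condition: choose the `f v` largest stars at each `v`. The chosen stars put at
most `min (f u + f v) (μ_G(uv))` edges on the pair `uv`. -/
theorem IsStarPacking.sum_sigma_le {G : Multigraph V} {M : V → Multiset ℕ}
    {P : Multiset (CentredStar V)} (hP : IsStarPacking G M P) {f : V → ℕ}
    (hf : ∀ v, f v ≤ (M v).card) :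
    ∑ v, sigma (f v) (M v) ≤ ∑ e : Sym2 V with ¬ e.IsDiag, G.cappedMult f e := by
  obtain ⟨hpack, hM⟩ := hP
  rw [isPacking_map_toMultigraph_iff] at hpack
  have hQ : ∀ v, ∃ Q : Multiset (CentredStar V), Q ≤ (P.filter fun S => S.centre = v) ∧
      Q.card = f v ∧ (Q.map CentredStar.size).sum = sigma (f v) (M v) := by
    intro v
    obtain ⟨T, hT, hsum⟩ := exists_sum_eq_sigma (hf v)
    nth_rw 1 [← hM v] at hT
    rw [Multiset.powersetCard_map, Multiset.mem_map] at hT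
    obtain ⟨Q, hQ, rfl⟩ := hT
    rw [Multiset.mem_powersetCard] at hQ
    exact ⟨Q, hQ.1, hQ.2, hsum⟩
  choose Q hQP hcard hsum using hQ
  have hbound : ∀ u v, ((Q u).map fun S => if v ∈ S.leaves then 1 else 0).sum ≤
      (P.map fun S => if S.centre = u ∧ v ∈ S.leaves then 1 else 0).sum := by
    intro u v
    rw [← card_filter_eq_sum_map, ← card_filter_eq_sum_map]
    refine (Multiset.card_le_card (Multiset.filter_le_filter _ (hQP u))).trans ?_
    rw [Multiset.filter_filter]
    simp only [and_comm, le_refl]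
  have hle : ∀ u v, ((Q u).map fun S => if v ∈ S.leaves then 1 else 0).sum ≤ f u := by
    intro u v
    rw [← card_filter_eq_sum_map, ← hcard u]
    exact Multiset.card_le_card (Multiset.filter_le _ _)
  simp only [← hsum, sum_map_size_eq]
  refine sum_sum_le_sum_sym2 (fun v => ?_) fun u v huv => ?_
  · refine Nat.le_zero.1 ((hbound v v).trans (Multiset.sum_eq_zero fun x hx => ?_).le)
    obtain ⟨S, -, rfl⟩ := Multiset.mem_map.1 hx
    rw [if_neg]
    rintro ⟨rfl, h⟩
    exact S.centre_notMem h
  · refine le_min (add_le_add (hle u v) (hle v u)) ?_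
    refine (add_le_add (hbound u v) (hbound v u)).trans ?_
    rw [← Multiset.sum_map_add]
    simpa only [CentredStar.mult_eq] using hpack u v huv

/-! ### Star packings as a transportation problem -/

/-- The transportation problem on `S`, `E` encodes the star packing problem for `G` and `M`: the
stars, indexed by `κ`, are elements `g k` of `S` with demand their size, and the pairs `z` of
distinct vertices are elements `pid z` of `E` with capacity their multiplicity. Further elements
of `S` and `E` have demand and capacity `0`. -/
structure IsEncoding {κ ι ε : Type*} [Fintype κ] (G : Multigraph V) (M : V → Multiset ℕ)
    (S : Finset ι) (E : Finset ε) (inc : ι → ε → Prop) (m : ι → ℕ) (cap : ε → ℕ) (g : κ → ι)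
    (centre : κ → V) (pid : Sym2 V → ε) : Prop where
  g_mem : ∀ k, g k ∈ S
  g_inj : Function.Injective g
  pos : ∀ k, 0 < m (g k)
  exists_of_ne_zero : ∀ s ∈ S, m s ≠ 0 → ∃ k, g k = s
  sizes : ∀ v, ((Finset.univ.filter fun k => centre k = v).val.map fun k => m (g k)) = M v
  pid_mem : ∀ z : Sym2 V, ¬ z.IsDiag → pid z ∈ E
  pid_inj : ∀ z w : Sym2 V, ¬ z.IsDiag → ¬ w.IsDiag → pid z = pid w → z = w
  cap_pid : ∀ u v, u ≠ v → cap (pid s(u, v)) = G.mult u v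
  inc_pid : ∀ k w, centre k ≠ w → inc (g k) (pid s(centre k, w))
  eq_pid_of_inc : ∀ k, ∀ e ∈ E, inc (g k) e → cap e ≠ 0 → ∃ w, centre k ≠ w ∧ e = pid s(centre k, w)

namespace IsEncoding

variable {κ ι ε : Type*} [Fintype κ] {G : Multigraph V} {M : V → Multiset ℕ}
  {S : Finset ι} {E : Finset ε} {inc : ι → ε → Prop} {m : ι → ℕ} {cap : ε → ℕ} {g : κ → ι}
  {centre : κ → V} {pid : Sym2 V → ε} {H : ℕ} {a : Flow ι ε}

/-- An obstruction to the transportation problem violates the condition on `G` and `M`. -/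
theorem exists_lt_sum_sigma [DecidableEq ι] [DecidableEq ε] [∀ s e, Decidable (inc s e)]
    (henc : IsEncoding G M S E inc m cap g centre pid) {A : Finset ι} (hA : A ⊆ S)
    (hlt : ∑ e ∈ E, min (cap e) (A.filter fun s => inc s e).card < ∑ s ∈ A, m s) :
    ∃ f : V → ℕ, (∀ v, f v ≤ (M v).card) ∧
      ∑ e : Sym2 V with ¬ e.IsDiag, G.cappedMult f e < ∑ v, sigma (f v) (M v) := by
  classical
  let B : V → Finset κ := fun v => Finset.univ.filter fun k => g k ∈ A ∧ centre k = v
  have hBM : ∀ v, ((B v).val.map fun k => m (g k)) ≤ M v := by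
    intro v
    rw [← henc.sizes v]
    refine Multiset.map_le_map (Finset.val_le_iff.2 fun k hk => ?_)
    simp only [B, Finset.mem_filter] at hk ⊢
    exact ⟨hk.1, hk.2.2⟩
  refine ⟨fun v => (B v).card, fun v => ?_, ?_⟩
  · simpa using Multiset.card_le_card (hBM v)
  have hsum : ∑ s ∈ A, m s ≤ ∑ v, sigma (B v).card (M v) := by
    have h1 : ∑ s ∈ A, m s ≤ ∑ k with g k ∈ A, m (g k) := by
      rw [← Finset.sum_image (f := m) (henc.g_inj.injOn)]
      refine Finset.sum_le_sum_of_ne_zero fun s hs hm => ?_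
      obtain ⟨k, rfl⟩ := henc.exists_of_ne_zero s (hA hs) hm
      exact Finset.mem_image.2 ⟨k, by simpa using hs, rfl⟩
    refine h1.trans ?_
    rw [← Finset.sum_fiberwise _ centre]
    refine Finset.sum_le_sum fun v _ => ?_
    rw [Finset.filter_filter]
    have := sum_le_sigma (hBM v)
    rw [Multiset.card_map] at this
    exact this
  refine lt_of_le_of_lt ?_ (hlt.trans_le hsum)
  have hinj : Set.InjOn pid
      ((Finset.univ.filter fun z : Sym2 V => ¬ z.IsDiag) : Finset (Sym2 V)) := by
    intro z hz w hw h
    exact henc.pid_inj z w (by simpa using hz) (by simpa using hw) h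
  have hsub : (Finset.univ.filter fun z : Sym2 V => ¬ z.IsDiag).image pid ⊆ E := by
    intro e he
    obtain ⟨z, hz, rfl⟩ := Finset.mem_image.1 he
    exact henc.pid_mem z (by simpa using hz)
  refine le_trans ?_ (Finset.sum_le_sum_of_subset hsub)
  rw [Finset.sum_image hinj]
  refine Finset.sum_le_sum fun z hz => ?_
  replace hz : ¬ z.IsDiag := by simpa using hz
  induction z using Sym2.ind with
  | _ u v =>
    have huv : u ≠ v := by simpa using hz
    rw [henc.cap_pid u v huv]
    refine le_min (min_le_right _ _) ((min_le_left _ _).trans ?_)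
    have hdisj : Disjoint (B u) (B v) := by
      rw [Finset.disjoint_left]
      intro k hk hk'
      simp only [B, Finset.mem_filter] at hk hk'
      exact huv (hk.2.2.symm.trans hk'.2.2)
    rw [← Finset.card_union_of_disjoint hdisj, ← Finset.card_image_of_injective _ henc.g_inj]
    refine Finset.card_le_card fun s hs => ?_
    obtain ⟨k, hk, rfl⟩ := Finset.mem_image.1 hs
    simp only [B, Finset.mem_union, Finset.mem_filter, Finset.mem_univ, true_and] at hk
    rw [Finset.mem_filter]
    rcases hk with ⟨hkA, rfl⟩ | ⟨hkA, rfl⟩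
    · exact ⟨hkA, henc.inc_pid k v huv⟩
    · rw [Sym2.eq_swap]
      exact ⟨hkA, henc.inc_pid k u huv.symm⟩

/-- The vertices to which the star `k` is joined in the assignment `a`. -/
def leafSet (a : Flow ι ε) (g : κ → ι) (centre : κ → V) (pid : Sym2 V → ε) (k : κ) : Finset V :=
  Finset.univ.filter fun w => centre k ≠ w ∧ a.X (g k) (pid s(centre k, w)) ≠ 0

theorem card_leafSet [DecidableEq ε] (henc : IsEncoding G M S E inc m cap g centre pid)
    (hv : Flow.Valid S E inc m cap H a) (k : κ) :
    (leafSet a g centre pid k).card = a.deg E (g k) := by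
  have hinj : Set.InjOn (fun w => pid s(centre k, w)) (leafSet a g centre pid k) := by
    intro w hw w' hw' h
    rw [Finset.mem_coe, leafSet, Finset.mem_filter] at hw hw'
    exact Sym2.congr_right.1
      (henc.pid_inj _ _ (by simpa using hw.2.1) (by simpa using hw'.2.1) h)
  have himg : (leafSet a g centre pid k).image (fun w => pid s(centre k, w)) =
      E.filter fun e => a.X (g k) e ≠ 0 := by
    ext e
    simp only [leafSet, Finset.mem_image, Finset.mem_filter, Finset.mem_univ, true_and]
    constructor
    · rintro ⟨w, ⟨hw, hX⟩, rfl⟩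
      exact ⟨henc.pid_mem _ (by simpa using hw), hX⟩
    · rintro ⟨he, hX⟩
      have hcap : cap e ≠ 0 := by
        rw [← hv.capacity e he]
        have : a.X (g k) e ≤ ∑ s ∈ S, a.X s e :=
          Finset.single_le_sum (f := fun s => a.X s e) (fun _ _ => Nat.zero_le _) (henc.g_mem k)
        omega
      obtain ⟨w, hw, rfl⟩ :=
        henc.eq_pid_of_inc k e he (hv.inc_of_X _ (henc.g_mem k) e he hX) hcap
      exact ⟨w, ⟨hw, hX⟩, rfl⟩
  rw [← Finset.card_image_of_injOn hinj, himg, Finset.card_filter]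
  refine Finset.sum_congr rfl fun e _ => ?_
  rcases hv.zero_or_one (g k) e with h | h <;> simp [h]

/-- The star `k` of a complete assignment. -/
def star [DecidableEq ε] (henc : IsEncoding G M S E inc m cap g centre pid)
    (hv : Flow.Valid S E inc m cap H a) (hd : ∀ s ∈ S, a.d s = 0) (k : κ) : CentredStar V where
  centre := centre k
  leaves := leafSet a g centre pid k
  nonempty := by
    rw [← Finset.card_pos, henc.card_leafSet hv]
    have h1 := hv.demand _ (henc.g_mem k)
    have h2 := hd _ (henc.g_mem k)
    have h3 := henc.pos k
    omega
  centre_notMem := by simp [leafSet]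

/-- A complete assignment is a packing. -/
theorem isStarPacking [DecidableEq ε] (henc : IsEncoding G M S E inc m cap g centre pid)
    (hv : Flow.Valid S E inc m cap H a) (hd : ∀ s ∈ S, a.d s = 0) :
    IsStarPacking G M ((Finset.univ : Finset κ).val.map (henc.star hv hd)) := by
  classical
  refine ⟨isPacking_map_toMultigraph_iff.2 fun u v huv => ?_, fun v => ?_⟩
  · rw [Multiset.map_map]
    have h1 : ∀ k, (henc.star hv hd k).toMultigraph.mult u v ≤ a.X (g k) (pid s(u, v)) := by
      intro k
      simp only [CentredStar.toMultigraph]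
      split_ifs with h
      · rw [Nat.one_le_iff_ne_zero]
        rcases h with ⟨rfl, h⟩ | ⟨rfl, h⟩
        · exact (Finset.mem_filter.1 h).2.2
        · rw [Sym2.eq_swap]
          exact (Finset.mem_filter.1 h).2.2
      · exact Nat.zero_le _
    calc ∑ k, (henc.star hv hd k).toMultigraph.mult u v
        ≤ ∑ k, a.X (g k) (pid s(u, v)) := Finset.sum_le_sum fun k _ => h1 k
      _ = ∑ s ∈ Finset.univ.image g, a.X s (pid s(u, v)) :=
        (Finset.sum_image (f := fun s => a.X s (pid s(u, v))) henc.g_inj.injOn).symm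
      _ ≤ ∑ s ∈ S, a.X s (pid s(u, v)) := by
        refine Finset.sum_le_sum_of_subset fun s hs => ?_
        obtain ⟨k, -, rfl⟩ := Finset.mem_image.1 hs
        exact henc.g_mem k
      _ ≤ G.mult u v := by
        have := hv.capacity _ (henc.pid_mem s(u, v) (by simpa using huv))
        rw [henc.cap_pid u v huv] at this
        omega
  · rw [Multiset.filter_map, Multiset.map_map, ← henc.sizes v, Finset.filter_val]
    refine Multiset.map_congr rfl fun k _ => ?_
    have h1 := hv.demand _ (henc.g_mem k)
    have h2 := hd _ (henc.g_mem k)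
    have h3 := henc.card_leafSet hv k
    simp only [Function.comp_apply, CentredStar.size, star]
    omega

/-- Once no move is possible, either the assignment is complete or the condition is violated. -/
theorem exists_lt_sum_sigma_of_stuck [DecidableEq ι] [DecidableEq ε]
    (henc : IsEncoding G M S E inc m cap g centre pid)
    (hv : Flow.Valid S E inc m cap H a) (hH : S.card ≤ H)
    (hst : ∀ s ∈ S, 0 < a.d s → H ≤ a.h s) {s₀ : ι} (hs₀ : s₀ ∈ S) (hd : a.d s₀ ≠ 0) :
    ∃ f : V → ℕ, (∀ v, f v ≤ (M v).card) ∧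
      ∑ e : Sym2 V with ¬ e.IsDiag, G.cappedMult f e < ∑ v, sigma (f v) (M v) := by
  classical
  obtain ⟨A, hA, hlt⟩ := Flow.exists_obstruction hv hs₀ (Nat.pos_of_ne_zero hd)
    (hH.trans (hst s₀ hs₀ (Nat.pos_of_ne_zero hd)))
  exact henc.exists_lt_sum_sigma hA hlt

end IsEncoding

/-- Sufficiency of the condition. -/
theorem exists_isStarPacking {G : Multigraph V} {M : V → Multiset ℕ} (hpos : ∀ v, ∀ m ∈ M v, 0 < m)
    (hcond : ∀ f : V → ℕ, (∀ v, f v ≤ (M v).card) →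
      ∑ v, sigma (f v) (M v) ≤ ∑ e : Sym2 V with ¬ e.IsDiag, G.cappedMult f e) :
    ∃ P : Multiset (CentredStar V), IsStarPacking G M P := by
  classical
  let κ := Σ v, Fin (M v).toList.length
  let m : κ → ℕ := fun k => (M k.1).toList.get k.2
  let inc : κ → Sym2 V → Prop := fun k z => k.1 ∈ z ∧ ¬ z.IsDiag
  let cap : Sym2 V → ℕ := Sym2.lift ⟨G.mult, G.symm⟩
  have henc : IsEncoding G M (Finset.univ : Finset κ) (Finset.univ : Finset (Sym2 V)) inc m cap
      id Sigma.fst id := by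
    refine ⟨fun _ => Finset.mem_univ _, Function.injective_id, fun k => ?_, fun s _ _ => ⟨s, rfl⟩,
      fun v => ?_, fun _ _ => Finset.mem_univ _, fun _ _ _ _ h => h, fun _ _ _ => rfl,
      fun k w h => ⟨by simp, by simpa using h⟩, ?_⟩
    · exact hpos k.1 _ (Multiset.mem_toList.1 (List.get_mem (M k.1).toList k.2))
    · have hfib : (Finset.univ.filter fun k : κ => k.1 = v) =
          (Finset.univ : Finset (Fin (M v).toList.length)).map
            ⟨fun i => (⟨v, i⟩ : κ), fun i j h => by simpa using h⟩ := by
        ext ⟨u, i⟩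
        simp only [Finset.mem_filter, Finset.mem_univ, true_and, Finset.mem_map]
        constructor
        · rintro rfl
          exact ⟨i, rfl⟩
        · rintro ⟨j, hj⟩
          exact (congrArg Sigma.fst hj).symm
      rw [hfib, Finset.map_val, Multiset.map_map]
      change Multiset.map (fun i => (M v).toList.get i) _ = _
      conv_rhs => rw [← Multiset.coe_toList (M v)]
      rw [show (Finset.univ : Finset (Fin (M v).toList.length)).val =
        ((List.finRange (M v).toList.length : List _) : Multiset _) from rfl, Multiset.map_coe,
        List.map_get_finRange]
    · rintro k z - ⟨hz, hd⟩ -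
      obtain ⟨w, rfl⟩ := Sym2.mem_iff_exists.1 hz
      exact ⟨w, by simpa using hd, rfl⟩
  obtain ⟨a, hv, hst⟩ := (Flow.valid_empty (S := Finset.univ) (E := Finset.univ) (inc := inc)
    (m := m) (cap := cap) (H := (Finset.univ : Finset κ).card)).exists_stuck
  by_cases hd : ∀ s ∈ Finset.univ, a.d s = 0
  · exact ⟨_, henc.isStarPacking hv hd⟩
  · push Not at hd
    obtain ⟨s₀, hs₀, hd⟩ := hd
    obtain ⟨f, hf, hlt⟩ := henc.exists_lt_sum_sigma_of_stuck hv le_rfl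
      (Flow.height_of_stuck hst) hs₀ hd
    exact absurd (hcond f hf) (not_le.2 hlt)

end Packing

/-! ### Logarithmic cost of programs without multiplication -/

/-- All numbers in the memory have at most `B` binary digits. -/
def Bounded (B : ℕ) (s : State) : Prop :=
  (∀ x, (s.reg x).size ≤ B) ∧ ∀ a i, (s.mem a i).size ≤ B

/-- Run on `s`, the program `p` halts in `s'` after at most `k` unit-cost steps, stated through its
logarithmic cost: no step lengthens the numbers by more than one digit, so on numbers of at most
`B` digits a step costs at most `1 + 3 * (B + k)`. -/
def Runs (p : Program) (s : State) (k : ℕ) (s' : State) : Prop :=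
  ∀ B, Bounded B s → ∃ t, Exec p s t s' ∧ t ≤ k * (1 + 3 * (B + k)) ∧ Bounded (B + k) s'

theorem Bounded.mono {B C : ℕ} {s : State} (h : Bounded B s) (hBC : B ≤ C) : Bounded C s :=
  ⟨fun x => (h.1 x).trans hBC, fun a i => (h.2 a i).trans hBC⟩

theorem Bounded.setReg {B : ℕ} {s : State} (h : Bounded B s) {x c : ℕ} (hc : c.size ≤ B) :
    Bounded B (s.setReg x c) := by
  refine ⟨fun y => ?_, h.2⟩
  simp only [State.setReg, Function.update_apply]
  split_ifs
  · exact hc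
  · exact h.1 y

theorem Bounded.setMem {B : ℕ} {s : State} (h : Bounded B s) {a i c : ℕ} (hc : c.size ≤ B) :
    Bounded B (s.setMem a i c) := by
  refine ⟨h.1, fun b j => ?_⟩
  simp only [State.setMem, Function.update_apply]
  split_ifs
  · simp only [Function.update_apply]
    split_ifs
    · exact hc
    · exact h.2 a j
  · exact h.2 b j

namespace Runs

variable {p q : Program} {s s' s'' : State} {k k' x y z a c : ℕ}

theorem mono (h : Runs p s k s') (hk : k ≤ k') : Runs p s k' s' := by
  intro B hB
  obtain ⟨t, h1, h2, h3⟩ := h B hB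
  exact ⟨t, h1, h2.trans (by gcongr), h3.mono (by omega)⟩

theorem seq (h : Runs p s k s') (h' : Runs q s' k' s'') :
    Runs (.seq p q) s (k + k') s'' := by
  intro B hB
  obtain ⟨t, h1, h2, h3⟩ := h B hB
  obtain ⟨t', h1', h2', h3'⟩ := h' _ h3
  refine ⟨_, .seq h1 h1', ?_, h3'.mono (by omega)⟩
  have : k * (1 + 3 * (B + k)) ≤ k * (1 + 3 * (B + k + k')) :=
    Nat.mul_le_mul_left _ (by omega)
  calc t + t' ≤ k * (1 + 3 * (B + k + k')) + k' * (1 + 3 * (B + k + k')) := by omega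
    _ = (k + k') * (1 + 3 * (B + (k + k'))) := by ring

theorem const : Runs (.const x c) s (1 + c.size) (s.setReg x c) := by
  intro B hB
  exact ⟨_, .const s x c, Nat.le_mul_of_pos_right _ (by omega),
    (hB.mono (by omega)).setReg (by omega)⟩

theorem copy : Runs (.copy x y) s 1 (s.setReg x (s.reg y)) := by
  intro B hB
  have := hB.1 y
  exact ⟨_, .copy s x y, by omega, (hB.mono (by omega)).setReg (by omega)⟩

theorem add : Runs (.arith .add x y z) s 1 (s.setReg x (s.reg y + s.reg z)) := by
  intro B hB
  have hy := hB.1 y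
  have hz := hB.1 z
  have h : (s.reg y + s.reg z).size ≤ B + 1 := by
    rw [Nat.size_le] at *
    rw [pow_succ]
    omega
  exact ⟨_, .arith s .add x y z, by simp only [ArithOp.eval]; omega,
    (hB.mono (by omega)).setReg h⟩

theorem sub : Runs (.arith .sub x y z) s 1 (s.setReg x (s.reg y - s.reg z)) := by
  intro B hB
  have hy := hB.1 y
  have hz := hB.1 z
  have h : (s.reg y - s.reg z).size ≤ B := (Nat.size_le_size (Nat.sub_le _ _)).trans hy
  exact ⟨_, .arith s .sub x y z, by simp only [ArithOp.eval]; omega,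
    (hB.mono (by omega)).setReg (h.trans (by omega))⟩

theorem load : Runs (.load x a y) s 1 (s.setReg x (s.mem a (s.reg y))) := by
  intro B hB
  have h1 := hB.1 y
  have h2 := hB.2 a (s.reg y)
  exact ⟨_, .load s x a y, by omega, (hB.mono (by omega)).setReg (by omega)⟩

theorem store : Runs (.store a y x) s 1 (s.setMem a (s.reg y) (s.reg x)) := by
  intro B hB
  have h1 := hB.1 y
  have h2 := hB.1 x
  exact ⟨_, .store s a y x, by omega, (hB.mono (by omega)).setMem (by omega)⟩

theorem write : Runs (.write x) s 1 { s with out := s.out ++ [s.reg x] } := by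
  intro B hB
  have h2 := hB.1 x
  exact ⟨_, .write s x, by omega, (hB.mono (by omega)).1, (hB.mono (by omega)).2⟩

theorem cond_pos (hx : s.reg x ≠ 0) (h : Runs p s k s') : Runs (.cond x p q) s (k + 1) s' := by
  intro B hB
  obtain ⟨t, h1, h2, h3⟩ := h B hB
  refine ⟨_, .cond_pos hx h1, ?_, h3.mono (by omega)⟩
  have := hB.1 x
  nlinarith

theorem cond_zero (hx : s.reg x = 0) (h : Runs q s k s') : Runs (.cond x p q) s (k + 1) s' := by
  intro B hB
  obtain ⟨t, h1, h2, h3⟩ := h B hB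
  refine ⟨_, .cond_zero hx h1, ?_, h3.mono (by omega)⟩
  have := hB.1 x
  nlinarith

theorem loop_zero (hx : s.reg x = 0) : Runs (.loop x p) s 1 s := by
  intro B hB
  have := hB.1 x
  exact ⟨_, .loop_zero hx, by omega, hB.mono (by omega)⟩

theorem loop_pos (hx : s.reg x ≠ 0) (h : Runs p s k s') (h' : Runs (.loop x p) s' k' s'') :
    Runs (.loop x p) s (1 + k + k') s'' := by
  intro B hB
  obtain ⟨t, h1, h2, h3⟩ := h B hB
  obtain ⟨t', h1', h2', h3'⟩ := h' _ h3
  refine ⟨_, .loop_pos hx h1 h1', ?_, h3'.mono (by omega)⟩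
  have hB := hB.1 x
  have : k * (1 + 3 * (B + k)) ≤ k * (1 + 3 * (B + (1 + k + k'))) :=
    Nat.mul_le_mul_left _ (by omega)
  have : k' * (1 + 3 * (B + k + k')) ≤ k' * (1 + 3 * (B + (1 + k + k'))) :=
    Nat.mul_le_mul_left _ (by omega)
  calc 1 + (s.reg x).size + t + t'
      ≤ 1 * (1 + 3 * (B + (1 + k + k'))) + k * (1 + 3 * (B + (1 + k + k'))) +
        k' * (1 + 3 * (B + (1 + k + k'))) := by omega
    _ = (1 + k + k') * (1 + 3 * (B + (1 + k + k'))) := by ring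

end Runs

/-! ### A language with expressions and bounded loops -/

/-- Expressions over the registers and arrays. -/
inductive Exp
  | var (x : ℕ)
  | num (c : ℕ)
  | add (e e' : Exp)
  | sub (e e' : Exp)
  | get (a : ℕ) (i : Exp)

namespace Exp

/-- The value of an expression. -/
def eval (s : State) : Exp → ℕ
  | var x => s.reg x
  | num c => c
  | add e e' => e.eval s + e'.eval s
  | sub e e' => e.eval s - e'.eval s
  | get a i => s.mem a (i.eval s)

/-- Only registers below `50` are used as variables. -/
def wf : Exp → Bool
  | var x => decide (x < 50)
  | num _ => true
  | add e e' => e.wf && e'.wf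
  | sub e e' => e.wf && e'.wf
  | get _ i => i.wf

/-- A program computing the expression in register `k`, with the registers from `k` on as a
stack. -/
def compile : Exp → ℕ → Program
  | var x, k => .copy k x
  | num c, k => .const k c
  | add e e', k => .seq (e.compile k) (.seq (e'.compile (k + 1)) (.arith .add k k (k + 1)))
  | sub e e', k => .seq (e.compile k) (.seq (e'.compile (k + 1)) (.arith .sub k k (k + 1)))
  | get a i, k => .seq (i.compile k) (.load k a k)

/-- The number of steps of the compiled expression. -/
def cost : Exp → ℕ
  | var _ => 1
  | num c => 1 + c.size
  | add e e' => e.cost + (e'.cost + 1)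
  | sub e e' => e.cost + (e'.cost + 1)
  | get _ i => i.cost + 1

end Exp

/-- The machine state `σ` agrees with `s` up to the stack, the registers from `50` on. -/
structure Sim (s σ : State) : Prop where
  reg : ∀ x < 50, σ.reg x = s.reg x
  mem : σ.mem = s.mem
  out : σ.out = s.out

theorem Exp.eval_sim {s σ : State} (h : Sim s σ) {e : Exp} (he : e.wf) : e.eval σ = e.eval s := by
  induction e with
  | var x => exact h.reg x (by simpa [wf] using he)
  | num c => rfl
  | add e e' ih ih' | sub e e' ih ih' =>
    simp only [wf, Bool.and_eq_true] at he
    simp only [eval, ih he.1, ih' he.2]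
  | get a i ih => simp only [eval, ih he, h.mem]

theorem Exp.runs_compile {e : Exp} (he : e.wf) {k : ℕ} (hk : 50 ≤ k) (σ : State) :
    ∃ σ', Runs (e.compile k) σ e.cost σ' ∧ σ'.reg k = e.eval σ ∧
      (∀ x < k, σ'.reg x = σ.reg x) ∧ σ'.mem = σ.mem ∧ σ'.out = σ.out := by
  induction e generalizing k σ with
  | var x => exact ⟨_, .copy, by simp [State.setReg, eval],
      fun y hy => by simp [State.setReg, hy.ne], rfl, rfl⟩
  | num c => exact ⟨_, .const, by simp [State.setReg, eval],
      fun y hy => by simp [State.setReg, hy.ne], rfl, rfl⟩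
  | add e e' ih ih' =>
    simp only [wf, Bool.and_eq_true] at he
    obtain ⟨σ₁, h1, h2, h3, h4, h5⟩ := ih he.1 hk σ
    obtain ⟨σ₂, g1, g2, g3, g4, g5⟩ := ih' he.2 (hk.trans (Nat.le_succ k)) σ₁
    refine ⟨_, h1.seq (g1.seq .add), ?_, fun y hy => ?_, g4.trans h4, g5.trans h5⟩
    · have hs : Sim σ σ₁ := ⟨fun x hx => h3 x (by omega), h4, h5⟩
      simp [State.setReg, eval, g2, g3 k (by omega), h2, eval_sim hs he.2]
    · simp [State.setReg, hy.ne, h3 y hy, g3 y (by omega)]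
  | sub e e' ih ih' =>
    simp only [wf, Bool.and_eq_true] at he
    obtain ⟨σ₁, h1, h2, h3, h4, h5⟩ := ih he.1 hk σ
    obtain ⟨σ₂, g1, g2, g3, g4, g5⟩ := ih' he.2 (hk.trans (Nat.le_succ k)) σ₁
    refine ⟨_, h1.seq (g1.seq .sub), ?_, fun y hy => ?_, g4.trans h4, g5.trans h5⟩
    · have hs : Sim σ σ₁ := ⟨fun x hx => h3 x (by omega), h4, h5⟩
      simp [State.setReg, eval, g2, g3 k (by omega), h2, eval_sim hs he.2]
    · simp [State.setReg, hy.ne, h3 y hy, g3 y (by omega)]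
  | get a i ih =>
    obtain ⟨σ₁, h1, h2, h3, h4, h5⟩ := ih he hk σ
    refine ⟨_, h1.seq .load, ?_, fun y hy => ?_, h4, h5⟩
    · simp [State.setReg, eval, h2, h4]
    · simp [State.setReg, hy.ne, h3 y hy]

/-- Commands. The loop `loop x c` runs `c` for `x = 0, …, ℓ - 1` in this order, where `ℓ` is the
content of register `0`, that is, the length of the input. -/
inductive Cmd
  | assign (x : ℕ) (e : Exp)
  | store (a : ℕ) (i e : Exp)
  | write (e : Exp)
  | seq (c c' : Cmd)
  | ite (e : Exp) (c c' : Cmd)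
  | loop (x : ℕ) (c : Cmd)
  | skip

/-- The state after `k` rounds of a loop over the register `x` with body `f`. -/
def rounds (f : State → State) (x : ℕ) (s : State) : ℕ → State
  | 0 => s.setReg x 0
  | k + 1 => (f (rounds f x s k)).setReg x (k + 1)

namespace Cmd

/-- The effect of a command. -/
def run : Cmd → State → State
  | assign x e, s => s.setReg x (e.eval s)
  | store a i e, s => s.setMem a (i.eval s) (e.eval s)
  | write e, s => { s with out := s.out ++ [e.eval s] }
  | seq c c', s => c'.run (c.run s)
  | ite e c c', s => if e.eval s ≠ 0 then c.run s else c'.run s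
  | loop x c, s => rounds c.run x s (s.reg 0)
  | skip, s => s

theorem run_ite_ne_zero {r : State} {e : Exp} {c c' : Cmd} (h : e.eval r ≠ 0) :
    (ite e c c').run r = c.run r :=
  if_pos h

theorem run_ite_zero {r : State} {e : Exp} {c c' : Cmd} (h : e.eval r = 0) :
    (ite e c c').run r = c'.run r :=
  if_neg (not_not.2 h)

theorem run_seq (c c' : Cmd) (r : State) : (seq c c').run r = c'.run (c.run r) :=
  rfl

/-- The registers that a command may change. -/
def regs : Cmd → List ℕ
  | assign x _ => [x]
  | store _ _ _ => []
  | write _ => []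
  | seq c c' => c.regs ++ c'.regs
  | ite _ c c' => c.regs ++ c'.regs
  | loop x c => x :: c.regs
  | skip => []

/-- The arrays that a command may change. -/
def arrays : Cmd → List ℕ
  | assign _ _ => []
  | store a _ _ => [a]
  | write _ => []
  | seq c c' => c.arrays ++ c'.arrays
  | ite _ c c' => c.arrays ++ c'.arrays
  | loop _ c => c.arrays
  | skip => []

/-- A command that never writes to the output. -/
def silent : Cmd → Bool
  | assign _ _ => true
  | store _ _ _ => true
  | write _ => false
  | seq c c' => c.silent && c'.silent
  | ite _ c c' => c.silent && c'.silent
  | loop _ c => c.silent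
  | skip => true

/-- Variables are registers below `50`, register `0` is never changed, and no loop body changes
the variable of its loop. -/
def wf : Cmd → Bool
  | assign x e => decide (0 < x) && decide (x < 50) && e.wf
  | store _ i e => i.wf && e.wf
  | write e => e.wf
  | seq c c' => c.wf && c'.wf
  | ite e c c' => e.wf && c.wf && c'.wf
  | loop x c => decide (0 < x) && decide (x < 50) && decide (x ∉ c.regs) && c.wf
  | skip => true

/-- Translation into a program of the random access machine. -/
def compile : Cmd → Program
  | assign x e => .seq (e.compile 50) (.copy x 50)
  | store a i e => .seq (i.compile 50) (.seq (e.compile 51) (.store a 50 51))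
  | write e => .seq (e.compile 50) (.write 50)
  | seq c c' => .seq c.compile c'.compile
  | ite e c c' => .seq (e.compile 50) (.cond 50 c.compile c'.compile)
  | loop x c => .seq (.const x 0) (.seq (.copy 50 0) (.loop 50 (.seq c.compile
      (.seq (.const 51 1) (.seq (.arith .add x x 51) (.arith .sub 50 0 x))))))
  | skip => .copy 50 50

/-- A bound on the number of steps of a command, as a polynomial in the content of register
`0`. -/
noncomputable def cost : Cmd → Polynomial ℕ
  | assign _ e => .C (e.cost + 1)
  | store _ i e => .C (i.cost + (e.cost + 1))
  | write e => .C (e.cost + 1)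
  | seq c c' => c.cost + c'.cost
  | ite e c c' => .C e.cost + (c.cost + c'.cost + 1)
  | loop _ c => 1 + (1 + (.X * (c.cost + 5) + 1))
  | skip => 1

theorem run_reg {c : Cmd} {x : ℕ} (hx : x ∉ c.regs) (s : State) : (c.run s).reg x = s.reg x := by
  induction c generalizing s with
  | assign y e =>
    have : x ≠ y := by simpa [regs] using hx
    simp [run, State.setReg, this]
  | store a i e => rfl
  | write e => rfl
  | seq c c' ih ih' =>
    simp only [regs, List.mem_append, not_or] at hx
    rw [run, ih' hx.2, ih hx.1]
  | ite e c c' ih ih' =>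
    simp only [regs, List.mem_append, not_or] at hx
    rw [run]
    split_ifs
    · rw [ih hx.1]
    · rw [ih' hx.2]
  | loop y c ih =>
    simp only [regs, List.mem_cons, not_or] at hx
    rw [run]
    generalize s.reg 0 = k
    induction k with
    | zero => simp [rounds, State.setReg, hx.1]
    | succ k ihk => rw [← ihk]; simp [rounds, State.setReg, hx.1, ih hx.2]
  | skip => rfl

theorem run_mem {c : Cmd} {a : ℕ} (ha : a ∉ c.arrays) (s : State) :
    (c.run s).mem a = s.mem a := by
  induction c generalizing s with
  | assign y e => rfl
  | store b i e =>
    have : a ≠ b := by simpa [arrays] using ha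
    simp [run, State.setMem, this]
  | write e => rfl
  | seq c c' ih ih' =>
    simp only [arrays, List.mem_append, not_or] at ha
    rw [run, ih' ha.2, ih ha.1]
  | ite e c c' ih ih' =>
    simp only [arrays, List.mem_append, not_or] at ha
    rw [run]
    split_ifs
    · rw [ih ha.1]
    · rw [ih' ha.2]
  | loop y c ih =>
    rw [run]
    generalize s.reg 0 = k
    induction k with
    | zero => rfl
    | succ k ihk =>
      rw [← ihk]
      exact ih ha _
  | skip => rfl

theorem run_out {c : Cmd} (hc : c.silent) (s : State) : (c.run s).out = s.out := by
  induction c generalizing s with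
  | assign y e => rfl
  | store b i e => rfl
  | write e => cases hc
  | seq c c' ih ih' =>
    simp only [silent, Bool.and_eq_true] at hc
    rw [run, ih' hc.2, ih hc.1]
  | ite e c c' ih ih' =>
    simp only [silent, Bool.and_eq_true] at hc
    rw [run]
    split_ifs
    · rw [ih hc.1]
    · rw [ih' hc.2]
  | loop y c ih =>
    rw [run]
    generalize s.reg 0 = k
    induction k with
    | zero => rfl
    | succ k ihk =>
      rw [← ihk]
      exact ih hc _
  | skip => rfl

/-- Register `0` keeps the length of the input. -/
theorem zero_notMem_regs {c : Cmd} (hc : c.wf) : 0 ∉ c.regs := by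
  induction c with
  | assign y e =>
    simp only [wf, Bool.and_eq_true, decide_eq_true_eq] at hc
    simp only [regs, List.mem_singleton]
    omega
  | seq c c' ih ih' =>
    simp only [wf, Bool.and_eq_true] at hc
    simp [regs, ih hc.1, ih' hc.2]
  | ite e c c' ih ih' =>
    simp only [wf, Bool.and_eq_true] at hc
    simp [regs, ih hc.1.2, ih' hc.2]
  | loop y c ih =>
    simp only [wf, Bool.and_eq_true, decide_eq_true_eq] at hc
    simp only [regs, List.mem_cons, not_or]
    exact ⟨by omega, ih hc.2⟩
  | _ => simp [regs]

/-- The rule for loops: an invariant that survives each round holds at the end. -/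
theorem run_loop_induction {c : Cmd} {x : ℕ} {s : State} (h0 : 0 ∉ c.regs) (hx : x ≠ 0)
    (Inv : ℕ → State → Prop) (hinit : Inv 0 (s.setReg x 0))
    (hstep : ∀ k < s.reg 0, ∀ r : State, r.reg 0 = s.reg 0 → r.reg x = k → Inv k r →
      Inv (k + 1) ((c.run r).setReg x (k + 1))) :
    Inv (s.reg 0) ((loop x c).run s) := by
  have key : ∀ k ≤ s.reg 0, (rounds c.run x s k).reg 0 = s.reg 0 ∧
      (rounds c.run x s k).reg x = k ∧ Inv k (rounds c.run x s k) := by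
    intro k
    induction k with
    | zero => exact fun _ => ⟨by simp [rounds, State.setReg, hx.symm],
        by simp [rounds, State.setReg], hinit⟩
    | succ k ih =>
      intro hk
      obtain ⟨h1, h2, h3⟩ := ih (by omega)
      refine ⟨?_, by simp [rounds, State.setReg], hstep k (by omega) _ h1 h2 h3⟩
      simp only [rounds, State.setReg, Function.update_of_ne hx.symm]
      rw [run_reg h0, h1]
  exact (key _ le_rfl).2.2

/-- The compiled command simulates the command within the stated number of steps. -/
theorem runs_compile {c : Cmd} (hc : c.wf) {s σ : State} (h : Sim s σ) :
    ∃ σ', Runs c.compile σ (c.cost.eval (s.reg 0)) σ' ∧ Sim (c.run s) σ' := by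
  induction c generalizing s σ with
  | assign x e =>
    simp only [wf, Bool.and_eq_true, decide_eq_true_eq] at hc
    obtain ⟨σ₁, h1, h2, h3, h4, h5⟩ := Exp.runs_compile hc.2 le_rfl σ
    refine ⟨_, (h1.seq .copy).mono (by simp [cost]),
      ⟨fun y hy => ?_, h4.trans h.mem, h5.trans h.out⟩⟩
    simp only [State.setReg, run, Function.update_apply]
    split_ifs
    · rw [h2, Exp.eval_sim h hc.2]
    · rw [h3 y hy, h.reg y hy]
  | store a i e =>
    simp only [wf, Bool.and_eq_true] at hc
    obtain ⟨σ₁, h1, h2, h3, h4, h5⟩ := Exp.runs_compile hc.1 le_rfl σ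
    obtain ⟨σ₂, g1, g2, g3, g4, g5⟩ := Exp.runs_compile hc.2 (Nat.le_succ 50) σ₁
    have hs : Sim s σ₁ := ⟨fun x hx => (h3 x hx).trans (h.reg x hx), h4.trans h.mem, h5.trans h.out⟩
    refine ⟨_, (h1.seq (g1.seq .store)).mono (by simp [cost]),
      ⟨fun y hy => ?_, ?_, g5.trans (h5.trans h.out)⟩⟩
    · exact (g3 y (by omega)).trans (hs.reg y hy)
    · simp only [State.setMem, run]
      rw [g2, g3 50 (by omega), h2, g4, h4, h.mem, Exp.eval_sim h hc.1, Exp.eval_sim hs hc.2]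
  | write e =>
    obtain ⟨σ₁, h1, h2, h3, h4, h5⟩ := Exp.runs_compile hc le_rfl σ
    refine ⟨_, (h1.seq .write).mono (by simp [cost]),
      ⟨fun y hy => (h3 y hy).trans (h.reg y hy), h4.trans h.mem, ?_⟩⟩
    simp only [run]
    rw [h2, h5, h.out, Exp.eval_sim h hc]
  | seq c c' ih ih' =>
    simp only [wf, Bool.and_eq_true] at hc
    obtain ⟨σ₁, h1, h2⟩ := ih hc.1 h
    obtain ⟨σ₂, g1, g2⟩ := ih' hc.2 h2
    refine ⟨σ₂, (h1.seq g1).mono ?_, g2⟩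
    rw [run_reg (zero_notMem_regs hc.1), cost, Polynomial.eval_add]
  | ite e c c' ih ih' =>
    simp only [wf, Bool.and_eq_true] at hc
    obtain ⟨σ₁, h1, h2, h3, h4, h5⟩ := Exp.runs_compile hc.1.1 le_rfl σ
    have hs : Sim s σ₁ := ⟨fun x hx => (h3 x hx).trans (h.reg x hx), h4.trans h.mem, h5.trans h.out⟩
    rw [Exp.eval_sim h hc.1.1] at h2
    obtain ⟨σ₂, g1, g2⟩ := ih hc.1.2 hs
    obtain ⟨σ₃, f1, f2⟩ := ih' hc.2 hs
    simp only [run, cost]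
    split_ifs with he
    · exact ⟨σ₂, (h1.seq (g1.cond_pos (h2 ▸ he))).mono (by simp), g2⟩
    · exact ⟨σ₃, (h1.seq (f1.cond_zero (h2.trans (not_not.1 he)))).mono (by simp), f2⟩
  | loop x c ih =>
    simp only [wf, Bool.and_eq_true, decide_eq_true_eq] at hc
    obtain ⟨⟨⟨hx0, hx⟩, hxc⟩, hwf⟩ := hc
    have h0c := zero_notMem_regs hwf
    -- the loop from round `k` on, with `j` rounds to go
    have key : ∀ j k σ, k + j = s.reg 0 → Sim (rounds c.run x s k) σ → σ.reg 50 = j →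
        (rounds c.run x s k).reg 0 = s.reg 0 → (rounds c.run x s k).reg x = k →
        ∃ σ', Runs (.loop 50 (.seq c.compile
          (.seq (.const 51 1) (.seq (.arith .add x x 51) (.arith .sub 50 0 x))))) σ
          (j * (c.cost.eval (s.reg 0) + 5) + 1) σ' ∧ Sim (rounds c.run x s (s.reg 0)) σ' := by
      intro j
      induction j with
      | zero =>
        intro k σ hk hsim h50 _ _
        rw [add_zero] at hk
        exact ⟨σ, (Runs.loop_zero h50).mono (by omega), hk ▸ hsim⟩
      | succ j ihj =>
        intro k σ hk hsim h50 hr0 hrx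
        obtain ⟨σ₁, h1, h2⟩ := ih hwf hsim
        rw [hr0] at h1
        have h0 : σ₁.reg 0 = s.reg 0 := by rw [h2.reg 0 (by omega), run_reg h0c, hr0]
        have hk' : σ₁.reg x = k := by rw [h2.reg x hx, run_reg hxc, hrx]
        obtain ⟨σ₂, g1, g2⟩ := ihj (k + 1)
          (((σ₁.setReg 51 1).setReg x (k + 1)).setReg 50 j) (by omega)
          ⟨fun y hy => by
            have : y ≠ 50 := by omega
            have : y ≠ 51 := by omega
            simp only [State.setReg, rounds, Function.update_apply]
            simp only [*, if_false, h2.reg y hy], h2.mem, h2.out⟩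
          (by simp [State.setReg])
          (by simp only [rounds, State.setReg, Function.update_of_ne hx0.ne]; rw [run_reg h0c, hr0])
          (by simp [rounds, State.setReg])
        have hbody : Runs (.seq c.compile (.seq (.const 51 1) (.seq (.arith .add x x 51)
            (.arith .sub 50 0 x)))) σ (c.cost.eval (s.reg 0) + ((1 + Nat.size 1) + (1 + 1)))
            (((σ₁.setReg 51 1).setReg x (k + 1)).setReg 50 j) := by
          refine h1.seq (Runs.const.seq ?_)
          have e1 : (σ₁.setReg 51 1).reg x + (σ₁.setReg 51 1).reg 51 = k + 1 := by
            have : x ≠ 51 := by omega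
            simp [State.setReg, this, hk']
          have e2 : ((σ₁.setReg 51 1).setReg x (k + 1)).reg 0 -
              ((σ₁.setReg 51 1).setReg x (k + 1)).reg x = j := by
            simp only [State.setReg, Function.update_self, Function.update_of_ne hx0.ne,
              Function.update_of_ne (show (0 : ℕ) ≠ 51 by omega), h0]
            omega
          rw [← e2]
          refine Runs.seq ?_ .sub
          rw [← e1]
          exact .add
        refine ⟨σ₂, (hbody.loop_pos (by omega) g1).mono ?_, g2⟩
        rw [Nat.size_one]
        ring_nf
        omega
    obtain ⟨σ₁, h1, h2⟩ := key (s.reg 0) 0 ((σ.setReg x 0).setReg 50 (s.reg 0)) (by omega)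
      ⟨fun y hy => by
        have : y ≠ 50 := by omega
        simp [rounds, State.setReg, Function.update_apply, this, h.reg y hy], h.mem, h.out⟩
      (by simp [State.setReg]) (by simp [rounds, State.setReg, hx0.ne])
      (by simp [rounds, State.setReg])
    refine ⟨σ₁, ?_, h2⟩
    have e1 : (σ.setReg x 0).reg 0 = s.reg 0 := by
      simp [State.setReg, hx0.ne, h.reg 0 (by omega)]
    refine ((Runs.const (x := x) (c := 0)).seq (Runs.seq (Runs.copy (x := 50) (y := 0))
      (e1.symm ▸ h1))).mono ?_
    rw [e1]
    simp [cost]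
  | skip =>
    refine ⟨_, Runs.copy.mono (by simp [cost]), ⟨fun y hy => ?_, h.mem, h.out⟩⟩
    rw [run, ← h.reg y hy]
    simp [State.setReg]

/-- A bound on the logarithmic cost of a command, as a polynomial in the size of the input. -/
noncomputable def time (c : Cmd) : Polynomial ℕ :=
  c.cost * (1 + 3 * (.X + c.cost))

theorem polynomial_eval_mono (T : Polynomial ℕ) {a b : ℕ} (h : a ≤ b) :
    T.eval a ≤ T.eval b := by
  rw [Polynomial.eval_eq_sum_range, Polynomial.eval_eq_sum_range]
  gcongr

theorem length_le_binarySize (w : List ℕ) : w.length ≤ binarySize w := by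
  induction w with
  | nil => rfl
  | cons a w ih =>
    simp only [binarySize, List.map_cons, List.sum_cons, List.length_cons] at *; omega

theorem size_le_binarySize {w : List ℕ} {a : ℕ} (h : a ∈ w) : a.size ≤ binarySize w :=
  (Nat.le_succ _).trans (List.single_le_sum (by simp) _
    (List.mem_map_of_mem (f := fun a => a.size + 1) h))

theorem bounded_init (w : List ℕ) : Bounded (binarySize w) (State.init w) := by
  have hsize : ∀ n : ℕ, n.size ≤ n := fun n => Nat.size_le.2 n.lt_two_pow_self
  constructor
  · intro x
    simp only [State.init]
    split_ifs
    · exact (hsize _).trans (length_le_binarySize w)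
    · simp
  · intro a i
    simp only [State.init]
    split_ifs
    · by_cases hi : i < w.length
      · rw [List.getD_eq_getElem _ _ hi]
        exact size_le_binarySize (List.getElem_mem hi)
      · rw [List.getD_eq_default _ _ (by omega)]
        simp
    · simp

/-- The compiled program halts in polynomial time, with the output of the command. -/
theorem exists_exec_compile {c : Cmd} (hc : c.wf) (w : List ℕ) :
    ∃ t σ, Exec c.compile (State.init w) t σ ∧ t ≤ c.time.eval (binarySize w) ∧
      σ.out = (c.run (State.init w)).out := by
  obtain ⟨σ, h1, h2⟩ := runs_compile hc (s := State.init w) ⟨fun _ _ => rfl, rfl, rfl⟩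
  obtain ⟨t, h3, h4, -⟩ := h1 _ (bounded_init w)
  refine ⟨t, σ, h3, h4.trans ?_, h2.out⟩
  have : c.cost.eval ((State.init w).reg 0) ≤ c.cost.eval (binarySize w) :=
    polynomial_eval_mono _ (length_le_binarySize w)
  simp only [time, Polynomial.eval_mul, Polynomial.eval_add, Polynomial.eval_one,
    Polynomial.eval_X, Polynomial.eval_ofNat]
  gcongr

end Cmd

namespace State

variable (s : State) (x y a b i j c : ℕ)

theorem setReg_reg : (s.setReg x c).reg y = if y = x then c else s.reg y :=
  Function.update_apply _ _ _ _

theorem setReg_mem : (s.setReg x c).mem = s.mem := rfl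

theorem setReg_out : (s.setReg x c).out = s.out := rfl

theorem setMem_reg : (s.setMem a i c).reg = s.reg := rfl

theorem setMem_out : (s.setMem a i c).out = s.out := rfl

theorem setMem_mem : (s.setMem a i c).mem a j = if j = i then c else s.mem a j := by
  simp [setMem, Function.update_apply]

theorem setMem_mem_of_ne {a b : ℕ} (h : b ≠ a) : (s.setMem a i c).mem b = s.mem b := by
  simp [setMem, h]

end State

attribute [local simp] State.setReg_reg State.setReg_mem State.setReg_out State.setMem_reg
  State.setMem_out State.setMem_mem State.setMem_mem_of_ne

/-! ### Reading the input -/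

namespace Algorithm

/-- Position of the entry `(i, j)` of a square matrix, array `1` holding the multiples of the side
length. -/
def entry (i j : Exp) : Exp := .add (.get 1 i) j

/-- Fill array `1` with the multiples of the length of the input. -/
def offsets : Cmd :=
  .seq (.assign 3 (.num 0)) <|
  .loop 4 <|
    .seq (.store 1 (.var 4) (.var 3)) <|
    .assign 3 (.add (.var 3) (.var 0))

/-- Register the pair `{u, v}` under the number `p`, the position of its multiplicity. -/
def readPair : Cmd :=
  .seq (.store 2 (entry (.var 4) (.var 5)) (.var 3)) <|
  .seq (.store 2 (entry (.var 5) (.var 4)) (.var 3)) <|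
  .seq (.store 3 (.var 3) (.get 0 (.var 3))) <|
  .assign 3 (.add (.var 3) (.num 1))

/-- Read `n` into register `2` and the multiplicities into array `3`, and number the pairs in the
symmetric matrix `2`. Register `3` is the reading position, registers `4` and `5` are `u` and
`v`. -/
def readPairs : Cmd :=
  .seq (.assign 2 (.get 0 (.num 0))) <|
  .seq (.assign 3 (.num 1)) <|
  .loop 4 <| .loop 5 <|
    .ite (.sub (.var 2) (.var 5)) (.ite (.sub (.var 5) (.var 4)) readPair .skip) .skip

/-- Read a star with centre `u`. -/
def readStar : Cmd :=
  .seq (.store 4 (.var 6) (.var 4)) <|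
  .seq (.store 5 (.var 6) (.get 0 (.var 3))) <|
  .seq (.store 6 (.var 6) (.get 0 (.var 3))) <|
  .seq (.assign 6 (.add (.var 6) (.num 1))) <|
  .assign 3 (.add (.var 3) (.num 1))

/-- Read the stars: their centres into array `4`, their sizes into arrays `5` and `6`, and their
number into register `6`. -/
def readStars : Cmd :=
  .seq (.assign 6 (.num 0)) <|
  .loop 4 <|
    .ite (.sub (.var 2) (.var 4))
      (.seq (.assign 7 (.get 0 (.var 3))) <|
       .seq (.assign 3 (.add (.var 3) (.num 1))) <|
       .loop 8 <| .ite (.sub (.var 7) (.var 8)) readStar .skip)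
      .skip

theorem entry_inj {ℓ a b c d : ℕ} (hb : b < ℓ) (hd : d < ℓ) :
    a * ℓ + b = c * ℓ + d ↔ a = c ∧ b = d := by
  constructor
  · intro h
    have hℓ : 0 < ℓ := by omega
    have h1 := congrArg (· / ℓ) h
    have h2 := congrArg (· % ℓ) h
    simp only [mul_comm _ ℓ, Nat.mul_add_div hℓ, Nat.div_eq_of_lt hb, Nat.div_eq_of_lt hd,
      Nat.mul_add_mod, Nat.mod_eq_of_lt hb, Nat.mod_eq_of_lt hd, add_zero] at h1 h2
    exact ⟨h1, h2⟩
  · rintro ⟨rfl, rfl⟩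
    rfl

theorem drop_eq_cons {α : Type*} {w l : List α} {p : ℕ} {a d : α} (h : w.drop p = a :: l) :
    p < w.length ∧ w.getD p d = a ∧ w.drop (p + 1) = l := by
  have hp : p < w.length := by
    by_contra hp
    rw [List.drop_eq_nil_of_le (by omega)] at h
    cases h
  rw [List.drop_eq_getElem_cons hp, List.cons.injEq] at h
  exact ⟨hp, by rw [List.getD_eq_getElem _ _ hp]; exact h.1, h.2⟩

theorem drop_range_of_lt {n k : ℕ} (h : k < n) :
    (List.range n).drop k = k :: (List.range n).drop (k + 1) := by
  rw [List.drop_eq_getElem_cons (by simpa using h), List.getElem_range]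

theorem drop_range_of_le {n k : ℕ} (h : n ≤ k) : (List.range n).drop k = [] :=
  List.drop_eq_nil_of_le (by simpa using h)

theorem offsets_run (s : State) : ∀ i < s.reg 0, (offsets.run s).mem 1 i = i * s.reg 0 := by
  have := Cmd.run_loop_induction (c := .seq (.store 1 (.var 4) (.var 3)) <|
    .assign 3 (.add (.var 3) (.var 0))) (x := 4) (s := s.setReg 3 0) (by decide) (by decide)
    (fun k r => r.reg 3 = k * s.reg 0 ∧ ∀ i < k, r.mem 1 i = i * s.reg 0)
    (by simp) ?_
  · exact this.2
  · rintro k hk r h0 hk4 ⟨h1, h2⟩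
    replace h0 : r.reg 0 = s.reg 0 := by simpa using h0
    simp only [Cmd.run, Exp.eval]
    refine ⟨by simp [h1, h0]; ring, fun i hi => ?_⟩
    simp only [State.setReg_mem, State.setMem_mem, hk4, h1]
    split_ifs with h
    · rw [h]
    · exact h2 i (by omega)

/-- The pairs `u < v` in `D` are numbered by the matrix `T` injectively and with positive numbers
below `p`, and `R` holds the multiplicity under the number of each pair. -/
structure PairTable (ℓ n : ℕ) (μ : ℕ → ℕ → ℕ) (D : ℕ → ℕ → Prop) (p : ℕ) (T : ℕ → ℕ → ℕ)
    (R : ℕ → ℕ) : Prop where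
  pos : 1 ≤ p
  zero : R 0 = 0
  lt : ∀ u v, D u v → u < v ∧ v < n
  off : ∀ a < ℓ, ∀ b < ℓ, ¬ D a b → ¬ D b a → T a b = 0
  symm : ∀ u v, D u v → T v u = T u v
  bound : ∀ u v, D u v → 1 ≤ T u v ∧ T u v < p ∧ T u v < ℓ
  mult : ∀ u v, D u v → R (T u v) = μ u v
  inj : ∀ u v u' v', D u v → D u' v' → T u v = T u' v' → u = u' ∧ v = v'

theorem PairTable.congr {ℓ n p : ℕ} {μ : ℕ → ℕ → ℕ} {R : ℕ → ℕ}
    {D D' : ℕ → ℕ → Prop} {T : ℕ → ℕ → ℕ}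
    (h : PairTable ℓ n μ D p T R) (hD : ∀ u v, D' u v ↔ D u v) : PairTable ℓ n μ D' p T R := by
  have : D' = D := by ext u v; exact hD u v
  rwa [this]

theorem PairTable.insert {ℓ n p u v : ℕ} {μ : ℕ → ℕ → ℕ} {R R' : ℕ → ℕ} {D D' : ℕ → ℕ → Prop}
    {T T' : ℕ → ℕ → ℕ} (h : PairTable ℓ n μ D p T R) (hnℓ : n ≤ ℓ) (huv : u < v) (hv : v < n)
    (hpℓ : p < ℓ)
    (hnew : ¬ D u v) (hD : ∀ a b, D' a b ↔ D a b ∨ (a = u ∧ b = v))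
    (hT : ∀ a < ℓ, ∀ b < ℓ, T' a b = if (a = v ∧ b = u) ∨ (a = u ∧ b = v) then p else T a b)
    (hR : ∀ e, R' e = if e = p then μ u v else R e) :
    PairTable ℓ n μ D' (p + 1) T' R' := by
  have key : ∀ a b, D a b → T' a b = T a b ∧ T' b a = T b a := by
    intro a b hab
    have hlt := h.lt a b hab
    rw [hT a (by omega) b (by omega), hT b (by omega) a (by omega), if_neg, if_neg]
    · exact ⟨rfl, rfl⟩
    · rintro (⟨rfl, rfl⟩ | ⟨rfl, rfl⟩)
      · exact hnew hab
      · omega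
    · rintro (⟨rfl, rfl⟩ | ⟨rfl, rfl⟩)
      · omega
      · exact hnew hab
  have e1 : T' u v = p := by rw [hT u (by omega) v (by omega), if_pos (Or.inr ⟨rfl, rfl⟩)]
  have e2 : T' v u = p := by rw [hT v (by omega) u (by omega), if_pos (Or.inl ⟨rfl, rfl⟩)]
  have hpos := h.pos
  refine ⟨by omega, ?_, ?_, ?_, ?_, ?_, ?_, ?_⟩
  · rw [hR, if_neg (by omega), h.zero]
  · intro a b hab
    rcases (hD a b).1 hab with hab | ⟨rfl, rfl⟩
    · exact h.lt a b hab
    · exact ⟨huv, hv⟩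
  · intro a ha b hb h1 h2
    rw [hD, not_or] at h1 h2
    rw [hT a ha b hb, if_neg, h.off a ha b hb h1.1 h2.1]
    rintro (⟨rfl, rfl⟩ | ⟨rfl, rfl⟩)
    · exact h2.2 ⟨rfl, rfl⟩
    · exact h1.2 ⟨rfl, rfl⟩
  · intro a b hab
    rcases (hD a b).1 hab with hab | ⟨rfl, rfl⟩
    · rw [(key a b hab).1, (key a b hab).2, h.symm a b hab]
    · rw [e1, e2]
  · intro a b hab
    rcases (hD a b).1 hab with hab | ⟨rfl, rfl⟩
    · rw [(key a b hab).1]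
      have := h.bound a b hab
      omega
    · omega
  · intro a b hab
    rcases (hD a b).1 hab with hab | ⟨rfl, rfl⟩
    · have := h.bound a b hab
      rw [(key a b hab).1, hR, if_neg (by omega), h.mult a b hab]
    · rw [e1, hR, if_pos rfl]
  · intro a b a' b' hab hab' heq
    rcases (hD a b).1 hab with hab | ⟨rfl, rfl⟩ <;> rcases (hD a' b').1 hab' with hab' | ⟨rfl, rfl⟩
    · rw [(key a b hab).1, (key a' b' hab').1] at heq
      exact h.inj a b a' b' hab hab' heq
    · rw [(key a b hab).1, e1] at heq
      have := h.bound a b hab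
      omega
    · rw [(key a' b' hab').1, e1] at heq
      have := h.bound a' b' hab'
      omega
    · exact ⟨rfl, rfl⟩

/-- The matrix numbering the pairs in a state. -/
def table (ℓ : ℕ) (s : State) (u v : ℕ) : ℕ := s.mem 2 (u * ℓ + v)

/-- The multiplicities of the pairs `u < v` in lexicographic order, from the rows in `L` on. -/
def pairRows (n : ℕ) (μ : ℕ → ℕ → ℕ) (L : List ℕ) : List ℕ :=
  L.flatMap fun u => ((List.range n).filter fun v => u < v).map (μ u)

/-- Reading the multiplicities numbers all pairs, and leaves the reading position at the entries for
the stars. -/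
theorem readPairs_run {s : State} {w rest : List ℕ} {n : ℕ} {μ : ℕ → ℕ → ℕ}
    (h0 : s.reg 0 = w.length) (hin : ∀ i, s.mem 0 i = w.getD i 0)
    (hoff : ∀ i < w.length, s.mem 1 i = i * w.length) (hT : ∀ i, s.mem 2 i = 0)
    (hR : ∀ i, s.mem 3 i = 0) (hw : w = n :: (pairRows n μ (List.range n) ++ rest))
    (hn : n ≤ w.length) :
    (readPairs.run s).reg 2 = n ∧ w.drop ((readPairs.run s).reg 3) = rest ∧
      PairTable w.length n μ (fun u v => u < v ∧ v < n) ((readPairs.run s).reg 3)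
        (table w.length (readPairs.run s)) ((readPairs.run s).mem 3) := by
  set ℓ := w.length with hℓ
  -- the invariant when the pairs before `(k, j)` have been read
  let Inv : ℕ → ℕ → State → Prop := fun k j r => r.reg 0 = ℓ ∧ r.mem 0 = s.mem 0 ∧
    r.mem 1 = s.mem 1 ∧ r.reg 2 = n ∧
    w.drop (r.reg 3) = (((List.range n).drop j).filter fun v => k < v).map (μ k) ++
      (pairRows n μ ((List.range n).drop (k + 1)) ++ rest) ∧
    PairTable ℓ n μ (fun u v => u < v ∧ v < n ∧ (u < k ∨ u = k ∧ v < j)) (r.reg 3) (table ℓ r)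
      (r.mem 3)
  have hset : ∀ {k j r} x c, x ≠ 0 → x ≠ 2 → x ≠ 3 → Inv k j r → Inv k j (r.setReg x c) := by
    rintro k j r x c h0 h2 h3 ⟨hI0, hI1, hI2, hI3, hI4, hI5⟩
    refine ⟨?_, hI1, hI2, ?_, ?_, ?_⟩ <;>
      simpa [h0.symm, h2.symm, h3.symm]
  have hstart : ∀ k r, r.reg 0 = ℓ → r.mem 0 = s.mem 0 → r.mem 1 = s.mem 1 → r.reg 2 = n →
      w.drop (r.reg 3) = pairRows n μ ((List.range n).drop k) ++ rest →
      PairTable ℓ n μ (fun u v => u < v ∧ v < n ∧ u < k) (r.reg 3) (table ℓ r) (r.mem 3) →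
      Inv k 0 r := by
    intro k r h1 h2 h3 h4 h5 h6
    refine ⟨h1, h2, h3, h4, ?_, h6.congr fun u v => by omega⟩
    rw [h5]
    rcases lt_or_ge k n with hk | hk
    · rw [drop_range_of_lt hk]
      simp [pairRows]
    · rw [drop_range_of_le hk, drop_range_of_le (by omega : n ≤ k + 1), List.drop_zero,
        List.filter_eq_nil_iff.2 (fun v hv => by simp at hv ⊢; omega)]
      simp [pairRows]
  have hinner : ∀ k r, k < ℓ → r.reg 4 = k → Inv k 0 r →
      Inv k ℓ ((Cmd.loop 5 <| .ite (.sub (.var 2) (.var 5))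
        (.ite (.sub (.var 5) (.var 4)) readPair .skip) .skip).run r) := by
    intro k r hk h4 hInv
    have hr0 : r.reg 0 = ℓ := hInv.1
    have := Cmd.run_loop_induction (c := .ite (.sub (.var 2) (.var 5))
      (.ite (.sub (.var 5) (.var 4)) readPair .skip) .skip) (x := 5) (s := r)
      (by decide) (by decide)
      (fun j r => r.reg 4 = k ∧ Inv k j r) ⟨by simpa using h4,
        hset 5 0 (by decide) (by decide) (by decide) hInv⟩ ?_
    · rw [hr0] at this
      exact this.2
    rintro j hj r' h0' h5' ⟨h4', hI⟩
    obtain ⟨hI0, hI1, hI2, hI3, hI4, hI5⟩ := id hI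
    rw [hr0] at hj
    suffices h : ((Cmd.ite (.sub (.var 2) (.var 5))
        (.ite (.sub (.var 5) (.var 4)) readPair .skip) .skip).run r').reg 4 = k ∧
        Inv k (j + 1) ((Cmd.ite (.sub (.var 2) (.var 5))
          (.ite (.sub (.var 5) (.var 4)) readPair .skip) .skip).run r') from
      ⟨by simpa using h.1, hset 5 _ (by decide) (by decide) (by decide) h.2⟩
    simp only [Cmd.run, Exp.eval, hI3, h5', h4']
    by_cases hjn : j < n
    · rw [if_pos (by omega)]
      by_cases hkj : k < j
      · rw [if_pos (by omega)]
        rw [drop_range_of_lt hjn, List.filter_cons_of_pos (by simpa using hkj), List.map_cons,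
          List.cons_append] at hI4
        obtain ⟨hp, hget, hdrop⟩ := drop_eq_cons (d := 0) hI4
        have ek : r'.mem 1 k = k * ℓ := by rw [hI2, hoff k hk]
        have ej : r'.mem 1 j = j * ℓ := by rw [hI2, hoff j hj]
        have ep : r'.mem 0 (r'.reg 3) = μ k j := by rw [hI1, hin, hget]
        refine ⟨by simp [readPair, Cmd.run, h4'], ?_⟩
        simp only [readPair, entry, Cmd.run, Exp.eval, Inv]
        refine ⟨by simp [hI0], by simp [hI1], by simp [hI2], by simp [hI3],
          by simpa using hdrop, ?_⟩
        simp only [State.setReg_reg, if_true, State.setMem_reg]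
        refine hI5.insert (u := k) (v := j) hn hkj hjn hp (by omega) (fun a b => by omega) ?_ ?_
        · intro a ha b hb
          simp only [table, h4', h5', ek, ej, State.setReg_mem, State.setMem_mem,
            State.setMem_mem_of_ne, ne_eq, Nat.reduceEqDiff,
            not_false_eq_true, OfNat.one_ne_ofNat, entry_inj hb hk, entry_inj hb hj]
          split_ifs <;> first | rfl | omega
        · intro e
          simp [ep]
      · rw [if_neg (by omega)]
        refine ⟨h4', hI0, hI1, hI2, hI3, ?_, hI5.congr fun u v => by omega⟩
        rwa [drop_range_of_lt hjn, List.filter_cons_of_neg (by simpa using hkj)] at hI4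
    · rw [if_neg (by omega)]
      refine ⟨h4', hI0, hI1, hI2, hI3, ?_, hI5.congr fun u v => by omega⟩
      rw [drop_range_of_le (by omega)] at hI4 ⊢
      exact hI4
  have hw1 : w.drop 1 = pairRows n μ (List.range n) ++ rest := by rw [hw]; rfl
  have hw0 : w.getD 0 0 = n := by rw [hw]; rfl
  have hr0 : ((s.setReg 2 n).setReg 3 1).reg 0 = ℓ := by simp [h0]
  have houter := Cmd.run_loop_induction (c := .loop 5 <| .ite (.sub (.var 2) (.var 5))
    (.ite (.sub (.var 5) (.var 4)) readPair .skip) .skip) (x := 4) (s := (s.setReg 2 n).setReg 3 1)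
    (by decide) (by decide) (fun k r => Inv k 0 r) ?_ ?_
  · have hrun : readPairs.run s = (Cmd.loop 4 (.loop 5 <| .ite (.sub (.var 2) (.var 5))
        (.ite (.sub (.var 5) (.var 4)) readPair .skip) .skip)).run ((s.setReg 2 n).setReg 3 1) := by
      simp only [readPairs, Cmd.run, Exp.eval, hin, hw0]
    rw [← hrun, hr0] at houter
    obtain ⟨-, -, -, h3, h4, h5⟩ := houter
    refine ⟨h3, ?_, h5.congr fun u v => by omega⟩
    rw [h4, drop_range_of_le (by omega : n ≤ ℓ + 1), List.drop_zero,
      List.filter_eq_nil_iff.2 (fun v hv => by simp at hv ⊢; omega)]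
    simp [pairRows]
  · refine hset 4 0 (by decide) (by decide) (by decide) (hstart 0 _ hr0 rfl rfl (by simp) ?_ ?_)
    · simpa using hw1
    · refine ⟨by simp, hR 0, fun u v h => by omega, fun a _ b _ _ _ => hT _, ?_, ?_, ?_, ?_⟩
      all_goals intro u v; intros; omega
  · intro k hk r h0' h4 hInv
    rw [hr0] at hk
    refine hset 4 _ (by decide) (by decide) (by decide) ?_
    obtain ⟨h1, h2, h3, h5, h6, h7⟩ := hinner k r hk h4 hInv
    refine hstart (k + 1) _ h1 h2 h3 h5 ?_ (h7.congr fun u v => by omega)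
    rw [h6, drop_range_of_le hn]
    rfl

/-- The entries for the stars, from the vertices in `L` on. -/
def starRows (sz : ℕ → List ℕ) (L : List ℕ) : List ℕ :=
  L.flatMap fun v => (sz v).length :: sz v

/-- The stars as pairs of a centre and a size, from the vertices in `L` on. -/
def starList (sz : ℕ → List ℕ) (L : List ℕ) : List (ℕ × ℕ) :=
  L.flatMap fun v => (sz v).map fun m => (v, m)

/-- The state holds the list `l` of stars in the arrays `4` and `6`, their number in register `6`,
and zeros behind them. -/
structure HoldsStars (s : State) (l : List (ℕ × ℕ)) : Prop where
  eq : (List.range (s.reg 6)).map (fun i => (s.mem 4 i, s.mem 6 i)) = l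
  zero : ∀ i, s.reg 6 ≤ i → s.mem 4 i = 0 ∧ s.mem 6 i = 0
  need : s.mem 5 = s.mem 6

theorem readStars_run {s : State} {w : List ℕ} {n : ℕ} {sz : ℕ → List ℕ}
    (h0 : s.reg 0 = w.length) (hin : ∀ i, s.mem 0 i = w.getD i 0) (h2 : s.reg 2 = n)
    (h4 : ∀ i, s.mem 4 i = 0) (h5 : ∀ i, s.mem 5 i = 0) (h6 : ∀ i, s.mem 6 i = 0)
    (hw : w.drop (s.reg 3) = starRows sz (List.range n)) (hn : n ≤ w.length) :
    HoldsStars (readStars.run s) (starList sz (List.range n)) := by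
  set ℓ := w.length with hℓ
  -- the invariant, with `L` and `l` the part of the input and of the stars that is still to come
  let Inv : List ℕ → List (ℕ × ℕ) → State → Prop := fun L l r => r.reg 0 = ℓ ∧
    r.mem 0 = s.mem 0 ∧ r.reg 2 = n ∧ w.drop (r.reg 3) = L ∧
    ∃ l', HoldsStars r l' ∧ l' ++ l = starList sz (List.range n)
  have hset : ∀ {L l r} x c, x ≠ 0 → x ≠ 2 → x ≠ 3 → x ≠ 6 → Inv L l r →
      Inv L l (r.setReg x c) := by
    rintro L l r x c h0 h2 h3 h6 ⟨hI0, hI1, hI2, hI3, l', hI4, hI5⟩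
    refine ⟨?_, hI1, ?_, ?_, l', ⟨?_, ?_, hI4.need⟩, hI5⟩
    · simpa [h0.symm]
    · simpa [h2.symm]
    · simpa [h3.symm]
    · simpa [h6.symm] using hI4.eq
    · simpa [h6.symm] using hI4.zero
  have hstar : ∀ k m L l r, r.reg 4 = k → Inv (m :: L) ((k, m) :: l) r →
      Inv L l (readStar.run r) := by
    rintro k m L l r hr4 ⟨hI0, hI1, hI2, hI3, l', ⟨heq, hzero, hneed⟩, hI5⟩
    obtain ⟨hp, hget, hdrop⟩ := drop_eq_cons (d := 0) hI3
    have ep : r.mem 0 (r.reg 3) = m := by rw [hI1, hin, hget]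
    simp only [readStar, Cmd.run, Exp.eval, Inv]
    refine ⟨by simp [hI0], by simp [hI1], by simp [hI2], by simpa using hdrop, l' ++ [(k, m)],
      ⟨?_, fun i hi => ?_, ?_⟩, by rw [List.append_assoc]; exact hI5⟩
    · simp only [State.setReg_reg, Nat.reduceEqDiff, if_false, if_true,
        State.setMem_reg, List.range_succ, List.map_append, List.map_singleton]
      congr 1
      · rw [← heq]
        refine List.map_congr_left fun i hi => ?_
        have : i ≠ r.reg 6 := (List.mem_range.1 hi).ne
        simp [this]
      · simp [hr4, ep]
    · replace hi : r.reg 6 + 1 ≤ i := by simpa using hi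
      have : i ≠ r.reg 6 := by omega
      simpa [this] using hzero i (by omega)
    · ext i
      simp [hneed]
  have hinner : ∀ k r L l, r.reg 4 = k → r.reg 7 = (sz k).length → (sz k).length ≤ ℓ →
      Inv (sz k ++ L) ((sz k).map (fun m => (k, m)) ++ l) r →
      Inv L l ((Cmd.loop 8 <| .ite (.sub (.var 7) (.var 8)) readStar .skip).run r) := by
    intro k r L l hr4 hr7 hlen hInv
    have hr0 : r.reg 0 = ℓ := hInv.1
    have := Cmd.run_loop_induction (c := .ite (.sub (.var 7) (.var 8)) readStar .skip) (x := 8)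
      (s := r) (by decide) (by decide)
      (fun j r => r.reg 4 = k ∧ r.reg 7 = (sz k).length ∧
        Inv ((sz k).drop j ++ L) (((sz k).drop j).map (fun m => (k, m)) ++ l) r)
      ⟨by simpa using hr4, by simpa using hr7,
        hset 8 0 (by decide) (by decide) (by decide) (by decide) hInv⟩ ?_
    · rw [hr0, List.drop_eq_nil_of_le hlen] at this
      exact this.2.2
    rintro j hj r' h0' h8' ⟨h4', h7', hI⟩
    have h4s : ((Cmd.ite (.sub (.var 7) (.var 8)) readStar .skip).run r').reg 4 = r'.reg 4 :=
      Cmd.run_reg (by decide) r'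
    have h7s : ((Cmd.ite (.sub (.var 7) (.var 8)) readStar .skip).run r').reg 7 = r'.reg 7 :=
      Cmd.run_reg (by decide) r'
    refine ⟨by simpa using h4s.trans h4', by simpa using h7s.trans h7',
      hset 8 _ (by decide) (by decide) (by decide) (by decide) ?_⟩
    simp only [Cmd.run, Exp.eval, h8', h7']
    by_cases hjl : j < (sz k).length
    · rw [if_pos (by omega)]
      rw [List.drop_eq_getElem_cons hjl] at hI
      exact hstar k _ _ _ r' h4' hI
    · rw [if_neg (by omega)]
      rw [List.drop_eq_nil_of_le (by omega)] at hI ⊢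
      exact hI
  have hr0 : (s.setReg 6 0).reg 0 = ℓ := by simp [h0]
  have houter := Cmd.run_loop_induction (c := .ite (.sub (.var 2) (.var 4))
      (.seq (.assign 7 (.get 0 (.var 3))) <|
       .seq (.assign 3 (.add (.var 3) (.num 1))) <|
       .loop 8 <| .ite (.sub (.var 7) (.var 8)) readStar .skip)
      .skip) (x := 4) (s := s.setReg 6 0) (by decide) (by decide)
    (fun k r => Inv (starRows sz ((List.range n).drop k)) (starList sz ((List.range n).drop k)) r)
    ?_ ?_
  · rw [hr0] at houter
    obtain ⟨-, -, -, -, l', h1, h2⟩ := houter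
    rw [drop_range_of_le hn] at h2
    rw [← h2, show starList sz [] = [] from rfl, List.append_nil]
    exact h1
  · refine hset 4 0 (by decide) (by decide) (by decide) (by decide)
      ⟨hr0, rfl, by simpa using h2, by simpa using hw, [], ⟨by simp, ?_, ?_⟩, by simp⟩
    · simp [h4, h6]
    · ext i
      simp [h5, h6]
  · intro k hk r h0' hk4 hI
    refine hset 4 _ (by decide) (by decide) (by decide) (by decide) ?_
    obtain ⟨hI0, hI1, hI2, hI3, l', ⟨heq, hzero, hneed⟩, hI5⟩ := id hI
    simp only [Cmd.run, Exp.eval, hk4, hI2]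
    by_cases hkn : k < n
    · rw [if_pos (by omega)]
      rw [drop_range_of_lt hkn] at hI3 hI5
      obtain ⟨hp, hget, hdrop⟩ := drop_eq_cons (d := 0) (show _ = (sz k).length ::
        (sz k ++ starRows sz ((List.range n).drop (k + 1))) from hI3)
      have ep : r.mem 0 (r.reg 3) = (sz k).length := by rw [hI1, hin, hget]
      have hlen : (sz k).length ≤ ℓ := by
        have := congrArg List.length hdrop
        simp only [List.length_drop, List.length_append] at this
        omega
      refine hinner k _ _ _ (by simpa using hk4) (by simpa using ep) hlen ?_
      refine ⟨by simpa using hI0, hI1, by simpa using hI2, by simpa using hdrop, l',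
        ⟨by simpa using heq, by simpa using hzero, hneed⟩, hI5⟩
    · rw [if_neg (by omega)]
      rw [drop_range_of_le (by omega)] at hI
      rwa [drop_range_of_le (by omega)]

end Algorithm

/-! ### The moves of the stars -/

namespace Algorithm

/-- The star `s` takes a free unit of the pair `e`. Registers `9`, `11`, `12` hold the star `s`, the
star `t` and the pair `e`, register `13` is set to `0` to report a move. -/
def takeUnit : Cmd :=
  .seq (.store 7 (entry (.var 9) (.var 12)) (.num 1)) <|
  .seq (.store 3 (.var 12) (.sub (.get 3 (.var 12)) (.num 1))) <|
  .seq (.store 5 (.var 9) (.sub (.get 5 (.var 9)) (.num 1))) <|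
  .assign 13 (.num 0)

/-- The star `s` takes over a unit of the pair `e` from the star `t`. -/
def stealUnit : Cmd :=
  .seq (.store 7 (entry (.var 9) (.var 12)) (.num 1)) <|
  .seq (.store 7 (entry (.var 11) (.var 12)) (.num 0)) <|
  .seq (.store 5 (.var 9) (.sub (.get 5 (.var 9)) (.num 1))) <|
  .seq (.store 5 (.var 11) (.add (.get 5 (.var 11)) (.num 1))) <|
  .assign 13 (.num 0)

/-- Make a move of `s` along `e`, possibly against `t`, if there is one. -/
def tryMove : Cmd :=
  .ite (.get 5 (.var 9))
    (.ite (.get 7 (entry (.var 9) (.var 12))) .skip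
      (.ite (.get 3 (.var 12)) takeUnit
        (.ite (.get 7 (entry (.var 11) (.var 12)))
          (.ite (.sub (.get 8 (.var 9)) (.get 8 (.var 11))) stealUnit .skip) .skip))) .skip

/-- Try all moves of the star `s`. -/
def tryMoves : Cmd :=
  .loop 10 <|
    .seq (.assign 12 (.get 2 (entry (.get 4 (.var 9)) (.var 10)))) <|
    .loop 11 tryMove

/-- Serve the star `s` if it lacks a unit and is not at the top: try all its moves, and lift it if
there is none. -/
def serve : Cmd :=
  .ite (.get 5 (.var 9))
    (.ite (.sub (.var 0) (.get 8 (.var 9)))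
      (.seq (.assign 13 (.num 1)) <|
       .seq tryMoves <|
       .ite (.var 13) (.store 8 (.var 9) (.add (.get 8 (.var 9)) (.num 1))) .skip) .skip) .skip

/-- Serve all stars. -/
def sweep : Cmd := .loop 9 serve

/-- Enough sweeps to exhaust the potential. -/
def sweeps : Cmd :=
  .loop 14 <| .loop 15 <| .loop 16 <| .seq (.seq sweep sweep) (.seq sweep sweep)

/-- The partial assignment held in a state, with stars and pairs numbered below `ℓ`. -/
def flow (ℓ : ℕ) (r : State) : Flow ℕ ℕ where
  X s e := if s < ℓ ∧ e < ℓ then r.mem 7 (s * ℓ + e) else 0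
  R := r.mem 3
  d := r.mem 5
  h := r.mem 8

/-- The parts of the memory that the sweeps do not change: the multiples of `ℓ`, the numbering `T`
of the pairs and the centres `cen` of the stars. -/
structure Layout (ℓ : ℕ) (T : ℕ → ℕ → ℕ) (cen : ℕ → ℕ) (r : State) : Prop where
  len : r.reg 0 = ℓ
  off : ∀ i < ℓ, r.mem 1 i = i * ℓ
  tab : ∀ u v, table ℓ r u v = T u v
  cen : ∀ i, r.mem 4 i = cen i

/-- The star `s` may use the pairs at its centre. -/
def Incident (ℓ : ℕ) (T : ℕ → ℕ → ℕ) (cen : ℕ → ℕ) (s e : ℕ) : Prop :=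
  ∃ w < ℓ, e = T (cen s) w

variable {ℓ : ℕ} {T : ℕ → ℕ → ℕ} {cen : ℕ → ℕ} {r : State}

theorem Layout.run (h : Layout ℓ T cen r) {c : Cmd} (h0 : 0 ∉ c.regs)
    (ha : 1 ∉ c.arrays ∧ 2 ∉ c.arrays ∧ 4 ∉ c.arrays) : Layout ℓ T cen (c.run r) where
  len := (Cmd.run_reg h0 r).trans h.len
  off := by rw [Cmd.run_mem ha.1]; exact h.off
  tab := by unfold table; rw [Cmd.run_mem ha.2.1]; exact h.tab
  cen := by rw [Cmd.run_mem ha.2.2]; exact h.cen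

theorem Layout.setReg (h : Layout ℓ T cen r) {x c : ℕ} (hx : x ≠ 0) :
    Layout ℓ T cen (r.setReg x c) where
  len := by simpa [hx.symm] using h.len
  off := h.off
  tab := h.tab
  cen := h.cen

theorem flow_setReg (x c : ℕ) : flow ℓ (r.setReg x c) = flow ℓ r := rfl

/-- The moves made by the sweeps. -/
abbrev Move (ℓ : ℕ) (T : ℕ → ℕ → ℕ) (cen : ℕ → ℕ) : Flow ℕ ℕ → Flow ℕ ℕ → Prop :=
  Flow.Step (Finset.range ℓ) (Finset.range ℓ) (Incident ℓ T cen) ℓ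

/-- No move of `s` along `e` against `t`. -/
def NoMove (a : Flow ℕ ℕ) (s e t : ℕ) : Prop :=
  a.X s e ≠ 0 ∨ a.R e = 0 ∧ (a.X t e ≠ 0 → a.h s ≤ a.h t)

theorem flow_takeUnit (hL : Layout ℓ T cen r) {s e : ℕ} (hs : s < ℓ) (he : e < ℓ) (h9 : r.reg 9 = s)
    (h12 : r.reg 12 = e) : flow ℓ (takeUnit.run r) = (flow ℓ r).take s e := by
  have hoff := hL.off s hs
  ext i j
  · simp only [flow, Flow.take, takeUnit, Cmd.run, Exp.eval, entry]
    by_cases hij : i < ℓ ∧ j < ℓ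
    · simp [h9, h12, hoff, hij, entry_inj hij.2 he]
    · have : ¬ (i = s ∧ j = e) := by omega
      simp [hij, this]
  · simp [flow, Flow.take, takeUnit, Cmd.run, Exp.eval, entry, h9, h12]
  · simp [flow, Flow.take, takeUnit, Cmd.run, Exp.eval, entry, h9, h12]
  · simp [flow, Flow.take, takeUnit, Cmd.run, Exp.eval, entry, h9, h12]

theorem flow_stealUnit (hL : Layout ℓ T cen r) {s t e : ℕ} (hs : s < ℓ) (ht : t < ℓ) (he : e < ℓ)
    (hst : t ≠ s) (h9 : r.reg 9 = s) (h11 : r.reg 11 = t) (h12 : r.reg 12 = e) :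
    flow ℓ (stealUnit.run r) = (flow ℓ r).steal s t e := by
  have hoff := hL.off s hs
  have hoff' := hL.off t ht
  ext i j
  · simp only [flow, Flow.steal, stealUnit, Cmd.run, Exp.eval, entry]
    by_cases hij : i < ℓ ∧ j < ℓ
    · simp [h9, h11, h12, hoff, hoff', hij, entry_inj hij.2 he]
    · have h1 : ¬ (i = s ∧ j = e) := by omega
      have h2 : ¬ (i = t ∧ j = e) := by omega
      simp [hij, h1, h2]
  · simp [flow, Flow.steal, stealUnit, Cmd.run, Exp.eval, entry]
  · simp [flow, Flow.steal, stealUnit, Cmd.run, Exp.eval, entry, h9, h11, hst]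
  · simp [flow, Flow.steal, stealUnit, Cmd.run, Exp.eval, entry]

/-- Either a move is made and reported, or nothing changes as there is no move. -/
theorem tryMove_run (hL : Layout ℓ T cen r) {s t e : ℕ} (hs : s < ℓ) (ht : t < ℓ) (he : e < ℓ)
    (hinc : Incident ℓ T cen s e) (h9 : r.reg 9 = s) (h11 : r.reg 11 = t) (h12 : r.reg 12 = e) :
    (tryMove.run r = r ∧ ((flow ℓ r).d s = 0 ∨ NoMove (flow ℓ r) s e t)) ∨
      ((tryMove.run r).reg 13 = 0 ∧ Move ℓ T cen (flow ℓ r) (flow ℓ (tryMove.run r))) := by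
  have hX : ∀ i < ℓ, (flow ℓ r).X i e = r.mem 7 (i * ℓ + e) := fun i hi => if_pos ⟨hi, he⟩
  simp only [tryMove, Cmd.run, Exp.eval, entry, h9, h11, h12, hL.off s hs, hL.off t ht, ← hX s hs,
    ← hX t ht]
  split_ifs with h1 h2 h3 h4 h5
  · exact Or.inl ⟨rfl, Or.inr (Or.inl h2)⟩
  · refine Or.inr ⟨by simp [takeUnit, Cmd.run, Exp.eval], ?_⟩
    rw [flow_takeUnit hL hs he h9 h12]
    exact Flow.Step.take s e (Finset.mem_range.2 hs) (Finset.mem_range.2 he) hinc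
      (Nat.pos_of_ne_zero h1) (not_not.1 h2) (Nat.pos_of_ne_zero h3)
  · refine Or.inr ⟨by simp [stealUnit, Cmd.run, Exp.eval], ?_⟩
    have hst : t ≠ s := by rintro rfl; exact h2 h4
    rw [flow_stealUnit hL hs ht he hst h9 h11 h12]
    exact Flow.Step.steal s t e (Finset.mem_range.2 hs) (Finset.mem_range.2 ht)
      (Finset.mem_range.2 he) hinc (Nat.pos_of_ne_zero h1) (not_not.1 h2) h4
      (Nat.lt_of_sub_ne_zero h5)
  · refine Or.inl ⟨rfl, Or.inr (Or.inr ⟨not_not.1 h3, fun _ => ?_⟩)⟩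
    exact Nat.sub_eq_zero_iff_le.1 (not_not.1 h5)
  · exact Or.inl ⟨rfl, Or.inr (Or.inr ⟨not_not.1 h3, fun h => absurd h h4⟩)⟩
  · exact Or.inl ⟨rfl, Or.inl (not_not.1 h1)⟩

/-- While the moves of the star `s` are tried, either a move has been made and reported, or nothing
has changed and the moves in `C` are known to be impossible. -/
def Tried (ℓ : ℕ) (T : ℕ → ℕ → ℕ) (cen : ℕ → ℕ) (a : Flow ℕ ℕ) (s : ℕ) (C : ℕ → ℕ → Prop)
    (r : State) : Prop :=
  Layout ℓ T cen r ∧ r.reg 9 = s ∧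
    (r.reg 13 = 0 ∧ Relation.TransGen (Move ℓ T cen) a (flow ℓ r) ∨
      r.reg 13 = 1 ∧ flow ℓ r = a ∧ ∀ e t, C e t → NoMove a s e t)

theorem Tried.setReg {a : Flow ℕ ℕ} {s x c : ℕ} {C : ℕ → ℕ → Prop} (h : Tried ℓ T cen a s C r)
    (h0 : x ≠ 0) (h9 : x ≠ 9) (h13 : x ≠ 13) : Tried ℓ T cen a s C (r.setReg x c) := by
  obtain ⟨h1, h2, h3⟩ := h
  refine ⟨h1.setReg h0, by simpa [h9.symm] using h2, ?_⟩
  simpa [h13.symm, flow_setReg] using h3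

theorem Tried.mono {a : Flow ℕ ℕ} {s : ℕ} {C C' : ℕ → ℕ → Prop} (h : Tried ℓ T cen a s C r)
    (hC : ∀ e t, C' e t → C e t) : Tried ℓ T cen a s C' r :=
  ⟨h.1, h.2.1, h.2.2.imp_right fun h => ⟨h.1, h.2.1, fun e t het => h.2.2 e t (hC e t het)⟩⟩

theorem tryMoves_run (hT : ∀ a < ℓ, ∀ b < ℓ, T a b < ℓ) (hcen : ∀ i, cen i < ℓ) {a : Flow ℕ ℕ}
    {s : ℕ} (hs : s < ℓ) (hd : 0 < a.d s) (h : Tried ℓ T cen a s (fun _ _ => False) r) :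
    Tried ℓ T cen a s (fun e t => Incident ℓ T cen s e ∧ t < ℓ) (tryMoves.run r) := by
  have hinner : ∀ w < ℓ, ∀ r C, r.reg 12 = T (cen s) w → Tried ℓ T cen a s C r →
      Tried ℓ T cen a s (fun e t => C e t ∨ (e = T (cen s) w ∧ t < ℓ))
        ((Cmd.loop 11 tryMove).run r) := by
    intro w hw r C h12 h
    have hr0 : r.reg 0 = ℓ := h.1.len
    have := Cmd.run_loop_induction (c := tryMove) (x := 11) (s := r) (by decide) (by decide)
      (fun k r => r.reg 12 = T (cen s) w ∧
        Tried ℓ T cen a s (fun e t => C e t ∨ (e = T (cen s) w ∧ t < k)) r)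
      ⟨by simpa using h12, (h.mono (by simp)).setReg (by decide) (by decide) (by decide)⟩ ?_
    · rw [hr0] at this
      exact this.2
    rintro k hk r' h0' h11' ⟨h12', h'⟩
    rw [hr0] at hk
    refine ⟨?_, Tried.setReg ?_ (by decide) (by decide) (by decide)⟩
    · have : (tryMove.run r').reg 12 = r'.reg 12 := Cmd.run_reg (by decide) r'
      simpa [this] using h12'
    obtain ⟨hL, h9, h'⟩ := h'
    refine ⟨hL.run (by decide) (by decide), (Cmd.run_reg (by decide) r').trans h9, ?_⟩
    rcases tryMove_run hL hs hk (hT _ (hcen s) w hw) ⟨w, hw, rfl⟩ h9 h11' h12' with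
      ⟨hrun, hno⟩ | ⟨h13, hmove⟩
    · rw [hrun]
      refine h'.imp_right fun ⟨h13, hflow, hC⟩ => ⟨h13, hflow, ?_⟩
      rintro e t (het | ⟨rfl, ht⟩)
      · exact hC e t (Or.inl het)
      · rcases Nat.lt_succ_iff_lt_or_eq.1 ht with ht | rfl
        · exact hC _ t (Or.inr ⟨rfl, ht⟩)
        · rw [hflow] at hno
          exact hno.resolve_left hd.ne'
    · refine Or.inl ⟨h13, ?_⟩
      rcases h' with ⟨-, h'⟩ | ⟨-, h', -⟩
      · exact h'.tail hmove
      · exact Relation.TransGen.single (h' ▸ hmove)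
  have hr0 : r.reg 0 = ℓ := h.1.len
  have := Cmd.run_loop_induction
    (c := .seq (.assign 12 (.get 2 (entry (.get 4 (.var 9)) (.var 10))))
    (.loop 11 tryMove)) (x := 10) (s := r) (by decide) (by decide)
    (fun k r => Tried ℓ T cen a s (fun e t => (∃ w < k, e = T (cen s) w) ∧ t < ℓ) r)
    ((h.mono (by simp)).setReg (by decide) (by decide) (by decide)) ?_
  · rw [hr0] at this
    exact this
  intro k hk r' h0' h10' h'
  rw [hr0] at hk
  refine Tried.setReg ?_ (by decide) (by decide) (by decide)
  have hL := h'.1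
  have h12 : Exp.eval r' (.get 2 (entry (.get 4 (.var 9)) (.var 10))) = T (cen s) k := by
    simp only [Exp.eval, entry, h'.2.1, h10', hL.cen, hL.off _ (hcen s)]
    exact hL.tab _ _
  refine (hinner k hk _ _ (by simpa using h12)
    (h'.setReg (x := 12) (by decide) (by decide) (by decide))).mono ?_
  rintro e t ⟨⟨w, hw, rfl⟩, ht⟩
  rcases Nat.lt_succ_iff_lt_or_eq.1 hw with hw | rfl
  · exact Or.inl ⟨⟨w, hw, rfl⟩, ht⟩
  · exact Or.inr ⟨rfl, ht⟩

/-- The star `s` lacks a unit and can still be lifted. -/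
def Active (ℓ : ℕ) (a : Flow ℕ ℕ) (s : ℕ) : Prop := a.d s ≠ 0 ∧ a.h s < ℓ

theorem serve_run (hT : ∀ a < ℓ, ∀ b < ℓ, T a b < ℓ) (hcen : ∀ i, cen i < ℓ)
    (hL : Layout ℓ T cen r) {s : ℕ} (hs : s < ℓ) (h9 : r.reg 9 = s) :
    (serve.run r = r ∧ ¬ Active ℓ (flow ℓ r) s) ∨ (Active ℓ (flow ℓ r) s ∧
      Relation.TransGen (Move ℓ T cen) (flow ℓ r) (flow ℓ (serve.run r))) := by
  by_cases h1 : (flow ℓ r).d s = 0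
  · refine Or.inl ⟨?_, fun h => h.1 h1⟩
    rw [serve, Cmd.run_ite_zero (by simpa [Exp.eval, h9, flow] using h1)]
    rfl
  have hrun : serve.run r = (Cmd.ite (.sub (.var 0) (.get 8 (.var 9)))
      (.seq (.assign 13 (.num 1)) <|
       .seq tryMoves <|
       .ite (.var 13) (.store 8 (.var 9) (.add (.get 8 (.var 9)) (.num 1))) .skip) .skip).run r :=
    Cmd.run_ite_ne_zero (by simpa [Exp.eval, h9, flow] using h1)
  by_cases h2 : ℓ ≤ (flow ℓ r).h s
  · refine Or.inl ⟨?_, fun h => h2.not_gt h.2⟩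
    rw [hrun, Cmd.run_ite_zero
      (by simpa [Exp.eval, h9, hL.len, Nat.sub_eq_zero_iff_le, flow] using h2)]
    rfl
  replace hrun := hrun.trans (Cmd.run_ite_ne_zero
    (by simpa [Exp.eval, h9, hL.len, Nat.sub_eq_zero_iff_le, flow] using h2))
  simp only [Cmd.run_seq] at hrun
  have hd := Nat.pos_of_ne_zero h1
  refine Or.inr ⟨⟨h1, not_le.1 h2⟩, ?_⟩
  obtain ⟨hL', h9', h'⟩ := tryMoves_run hT hcen hs hd
    (r := (Cmd.assign 13 (.num 1)).run r) (a := flow ℓ r) ⟨hL.setReg (by decide),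
      by simpa [Cmd.run] using h9, Or.inr ⟨by simp [Cmd.run, Exp.eval], rfl, fun _ _ h => h.elim⟩⟩
  rcases h' with ⟨h13, h'⟩ | ⟨h13, hflow, hno⟩
  · rw [hrun, Cmd.run_ite_zero (by simpa only [Exp.eval] using h13)]
    exact h'
  · rw [hrun, Cmd.run_ite_ne_zero (by simp [Exp.eval, h13])]
    refine Relation.TransGen.single ?_
    have : flow ℓ ((Cmd.store 8 (.var 9) (.add (.get 8 (.var 9)) (.num 1))).run
        (tryMoves.run ((Cmd.assign 13 (.num 1)).run r))) = (flow ℓ r).relabel s := by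
      rw [← hflow]
      generalize tryMoves.run ((Cmd.assign 13 (.num 1)).run r) = r' at h9'
      ext i j <;> simp [flow, Flow.relabel, h9', Cmd.run, Exp.eval]
    rw [this]
    refine Flow.Step.relabel s (Finset.mem_range.2 hs) hd (not_le.1 h2)
      fun e he hinc hX => ⟨?_, fun t ht => ?_⟩
    · exact ((hno e s ⟨hinc, hs⟩).resolve_left (fun h => h hX)).1
    · exact ((hno e t ⟨hinc, Finset.mem_range.1 ht⟩).resolve_left (fun h => h hX)).2

/-- If some star is active, then a sweep makes a move; otherwise it changes nothing. -/
theorem sweep_run (hT : ∀ a < ℓ, ∀ b < ℓ, T a b < ℓ) (hcen : ∀ i, cen i < ℓ)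
    (hL : Layout ℓ T cen r) :
    (flow ℓ (sweep.run r) = flow ℓ r ∧ ∀ s < ℓ, ¬ Active ℓ (flow ℓ r) s) ∨
      ((∃ s < ℓ, Active ℓ (flow ℓ r) s) ∧
        Relation.TransGen (Move ℓ T cen) (flow ℓ r) (flow ℓ (sweep.run r))) := by
  have := Cmd.run_loop_induction (c := serve) (x := 9) (s := r) (by decide) (by decide)
    (fun k r' => Layout ℓ T cen r' ∧ ((flow ℓ r' = flow ℓ r ∧ ∀ s < k, ¬ Active ℓ (flow ℓ r) s) ∨
      ((∃ s < ℓ, Active ℓ (flow ℓ r) s) ∧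
        Relation.TransGen (Move ℓ T cen) (flow ℓ r) (flow ℓ r'))))
    ⟨hL.setReg (by decide), Or.inl ⟨rfl, by simp⟩⟩ ?_
  · rw [hL.len] at this
    exact this.2
  rintro k hk r' - h9 ⟨hL', h'⟩
  rw [hL.len] at hk
  refine ⟨(hL'.run (by decide) (by decide)).setReg (by decide), ?_⟩
  rw [flow_setReg]
  rcases serve_run hT hcen hL' hk h9 with ⟨hrun, hact⟩ | ⟨hact, hmove⟩
  · rw [hrun]
    refine h'.imp_left fun ⟨hflow, hno⟩ => ⟨hflow, fun s hs => ?_⟩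
    rcases Nat.lt_succ_iff_lt_or_eq.1 hs with hs | rfl
    · exact hno s hs
    · rwa [← hflow]
  · right
    rcases h' with ⟨hflow, -⟩ | ⟨hex, hmoves⟩
    · rw [← hflow]
      exact ⟨⟨k, hk, hact⟩, hmove⟩
    · exact ⟨hex, hmoves.trans hmove⟩

/-- The state holds a valid assignment, and either no star is active or the potential has reached
`N`. -/
def Progress (ℓ : ℕ) (T : ℕ → ℕ → ℕ) (cen m cap : ℕ → ℕ) (N : ℕ) (r : State) : Prop :=
  Layout ℓ T cen r ∧
    (flow ℓ r).Valid (Finset.range ℓ) (Finset.range ℓ) (Incident ℓ T cen) m cap ℓ ∧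
    ((∀ s < ℓ, ¬ Active ℓ (flow ℓ r) s) ∨
      N ≤ (flow ℓ r).potential (Finset.range ℓ) (Finset.range ℓ))

variable {m cap : ℕ → ℕ} {N K : ℕ}

theorem Progress.setReg (h : Progress ℓ T cen m cap N r) {x c : ℕ} (hx : x ≠ 0) :
    Progress ℓ T cen m cap N (r.setReg x c) :=
  ⟨h.1.setReg hx, h.2⟩

theorem valid_and_potential_lt_of_transGen {a b : Flow ℕ ℕ}
    (ha : a.Valid (Finset.range ℓ) (Finset.range ℓ) (Incident ℓ T cen) m cap ℓ)
    (h : Relation.TransGen (Move ℓ T cen) a b) :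
    b.Valid (Finset.range ℓ) (Finset.range ℓ) (Incident ℓ T cen) m cap ℓ ∧
      a.potential (Finset.range ℓ) (Finset.range ℓ) <
        b.potential (Finset.range ℓ) (Finset.range ℓ) := by
  induction h with
  | single h => exact ⟨h.valid ha, h.potential_lt ha⟩
  | tail _ h ih => exact ⟨h.valid ih.1, ih.2.trans (h.potential_lt ih.1)⟩

theorem Progress.sweep (hT : ∀ a < ℓ, ∀ b < ℓ, T a b < ℓ) (hcen : ∀ i, cen i < ℓ)
    (h : Progress ℓ T cen m cap N r) : Progress ℓ T cen m cap (N + 1) (sweep.run r) := by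
  obtain ⟨hL, hv, h⟩ := h
  refine ⟨hL.run (by decide) (by decide), ?_⟩
  rcases sweep_run hT hcen hL with ⟨hflow, hno⟩ | ⟨⟨s, hs, hact⟩, hmove⟩
  · rw [hflow]
    exact ⟨hv, Or.inl hno⟩
  · have := valid_and_potential_lt_of_transGen hv hmove
    refine ⟨this.1, Or.inr ?_⟩
    rcases h with h | h
    · exact absurd hact (h s hs)
    · omega

theorem Progress.loop {c : Cmd} {x : ℕ} (h0 : 0 ∉ c.regs) (hx : x ≠ 0)
    (hc : ∀ N r, Progress ℓ T cen m cap N r → Progress ℓ T cen m cap (N + K) (c.run r))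
    (h : Progress ℓ T cen m cap N r) :
    Progress ℓ T cen m cap (N + ℓ * K) ((Cmd.loop x c).run r) := by
  have := Cmd.run_loop_induction (s := r) h0 hx
    (fun k r => Progress ℓ T cen m cap (N + k * K) r) ?_ ?_
  · rw [h.1.len] at this
    exact this
  · simpa using h.setReg hx
  · intro k _ r' _ _ h'
    have := (hc _ _ h').setReg (x := x) (c := k + 1) hx
    rwa [add_assoc, ← Nat.succ_mul] at this

/-- After all sweeps no star is active: `4 * ℓ ^ 3` exceeds the bound `ℓ * (ℓ * (ℓ + 1) + ℓ)` on the
potential. -/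
theorem sweeps_run (hT : ∀ a < ℓ, ∀ b < ℓ, T a b < ℓ) (hcen : ∀ i, cen i < ℓ)
    (h : Progress ℓ T cen m cap 0 r) :
    (flow ℓ (sweeps.run r)).Valid (Finset.range ℓ) (Finset.range ℓ) (Incident ℓ T cen) m cap ℓ ∧
      ∀ s ∈ Finset.range ℓ, 0 < (flow ℓ (sweeps.run r)).d s →
        ℓ ≤ (flow ℓ (sweeps.run r)).h s := by
  have h4 : ∀ N r, Progress ℓ T cen m cap N r → Progress ℓ T cen m cap (N + 4)
      ((Cmd.seq (.seq sweep sweep) (.seq sweep sweep)).run r) := fun N r h =>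
    (((h.sweep hT hcen).sweep hT hcen).sweep hT hcen).sweep hT hcen
  have hall : Progress ℓ T cen m cap (0 + ℓ * (ℓ * (ℓ * 4))) (sweeps.run r) :=
    Progress.loop (by decide) (by decide) (fun _ _ => Progress.loop (by decide) (by decide)
      (fun _ _ => Progress.loop (by decide) (by decide) h4)) h
  obtain ⟨-, hv, hall⟩ := hall
  refine ⟨hv, fun s hs hd => ?_⟩
  by_contra! hlt
  rcases hall with hall | hall
  · exact hall s (Finset.mem_range.1 hs) ⟨hd.ne', hlt⟩
  · have h1 := hv.potential_le
    rw [Finset.card_range] at h1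
    have hℓ : 1 ≤ ℓ := by have := Finset.mem_range.1 hs; omega
    have h2 : 0 + ℓ * (ℓ * (ℓ * 4)) ≤ ℓ * (ℓ * (ℓ + 1) + ℓ) := hall.trans h1
    have h3 : ℓ * (ℓ * 4) ≤ ℓ * (ℓ + 1) + ℓ := by
      rw [zero_add] at h2
      exact Nat.le_of_mul_le_mul_left h2 hℓ
    nlinarith

end Algorithm

/-! ### The output -/

namespace Algorithm

/-- Set register `17` to `1` if some star still lacks a unit, otherwise to `0`. -/
def check : Cmd :=
  .seq (.assign 17 (.num 0)) <|
  .loop 9 <| .ite (.get 5 (.var 9)) (.assign 17 (.num 1)) .skip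

/-- Write the leaves of the star `s`. -/
def writeLeaves : Cmd :=
  .loop 10 <|
    .seq (.assign 12 (.get 2 (entry (.get 4 (.var 9)) (.var 10)))) <|
    .ite (.get 7 (entry (.var 9) (.var 12))) (.write (.var 10)) .skip

/-- Write the stars, each with its centre, its size and its leaves. -/
def writeStars : Cmd :=
  .loop 9 <| .ite (.sub (.var 6) (.var 9))
    (.seq (.write (.get 4 (.var 9))) <| .seq (.write (.get 6 (.var 9))) writeLeaves) .skip

/-- Write the answer. -/
def answer : Cmd :=
  .seq check <| .ite (.var 17) (.write (.num 0)) <|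
    .seq (.write (.num 1)) <| .seq (.write (.var 6)) writeStars

/-- The whole algorithm. -/
def algorithm : Cmd :=
  .seq offsets <| .seq readPairs <| .seq readStars <| .seq sweeps answer

variable {ℓ : ℕ} {T : ℕ → ℕ → ℕ} {cen : ℕ → ℕ} {r : State}

theorem check_run (r : State) : (check.run r).reg 17 = 0 ↔ ∀ s < r.reg 0, r.mem 5 s = 0 := by
  have := Cmd.run_loop_induction (c := .ite (.get 5 (.var 9)) (.assign 17 (.num 1)) .skip) (x := 9)
    (s := r.setReg 17 0) (by decide) (by decide)
    (fun k r' => r'.mem 5 = r.mem 5 ∧ (r'.reg 17 = 0 ↔ ∀ s < k, r.mem 5 s = 0)) (by simp) ?_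
  · exact this.2
  rintro k hk r' - h9 ⟨h5, h17⟩
  refine ⟨by simp [Cmd.run_mem (show 5 ∉ (Cmd.ite (.get 5 (.var 9))
    (.assign 17 (.num 1)) .skip).arrays by decide), h5], ?_⟩
  by_cases h : r.mem 5 k = 0
  · rw [Cmd.run_ite_zero (by simpa [Exp.eval, h9, h5] using h)]
    simp only [Cmd.run, State.setReg_reg, Nat.reduceEqDiff, if_false, h17]
    refine ⟨fun hs s hk => ?_, fun hs s hk => hs s (by omega)⟩
    rcases Nat.lt_succ_iff_lt_or_eq.1 hk with hk | rfl
    · exact hs s hk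
    · exact h
  · rw [Cmd.run_ite_ne_zero (by simpa [Exp.eval, h9, h5] using h)]
    simp only [Cmd.run, Exp.eval, State.setReg_reg, Nat.reduceEqDiff, if_false, if_true,
      one_ne_zero, false_iff]
    exact fun hs => h (hs k (by omega))

/-- The leaves of the star `s` in the assignment held in the state. -/
def leafList (ℓ : ℕ) (T : ℕ → ℕ → ℕ) (cen : ℕ → ℕ) (a : Flow ℕ ℕ) (s : ℕ) : List ℕ :=
  (List.range ℓ).filter fun w => a.X s (T (cen s) w) ≠ 0

theorem writeLeaves_run (hT : ∀ a < ℓ, ∀ b < ℓ, T a b < ℓ) (hcen : ∀ i, cen i < ℓ)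
    (hL : Layout ℓ T cen r) {s : ℕ} (hs : s < ℓ) (h9 : r.reg 9 = s) :
    (writeLeaves.run r).out = r.out ++ leafList ℓ T cen (flow ℓ r) s := by
  have := Cmd.run_loop_induction
    (c := .seq (.assign 12 (.get 2 (entry (.get 4 (.var 9)) (.var 10)))) <|
    .ite (.get 7 (entry (.var 9) (.var 12))) (.write (.var 10)) .skip) (x := 10)
    (s := r) (by decide) (by decide)
    (fun k r' => Layout ℓ T cen r' ∧ r'.reg 9 = s ∧ r'.mem 7 = r.mem 7 ∧ r'.out = r.out ++
      (List.range k).filter fun w => (flow ℓ r).X s (T (cen s) w) ≠ 0)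
    ⟨hL.setReg (by decide), by simpa using h9, rfl, by simp⟩ ?_
  · rw [hL.len] at this
    exact this.2.2.2
  rintro k hk r' - h10 ⟨hL', h9', h7, hout⟩
  rw [hL.len] at hk
  refine ⟨(hL'.run (by decide) (by decide)).setReg (by decide), ?_, ?_, ?_⟩
  · simp only [State.setReg_reg, Nat.reduceEqDiff, if_false]
    exact (Cmd.run_reg (by decide) r').trans h9'
  · exact (Cmd.run_mem (by decide) r').trans h7
  have e12 : Exp.eval r' (.get 2 (entry (.get 4 (.var 9)) (.var 10))) = T (cen s) k := by
    simp only [Exp.eval, entry, h9', h10, hL'.cen, hL'.off _ (hcen s)]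
    exact hL'.tab _ _
  have eX : (flow ℓ r).X s (T (cen s) k) = r.mem 7 (s * ℓ + T (cen s) k) :=
    if_pos ⟨hs, hT _ (hcen s) k hk⟩
  have ev : Exp.eval (r'.setReg 12 (T (cen s) k)) (.get 7 (entry (.var 9) (.var 12))) =
      (flow ℓ r).X s (T (cen s) k) := by
    rw [eX]
    simp [Exp.eval, entry, h9', hL'.off s hs, h7]
  rw [State.setReg_out, Cmd.run_seq, Cmd.run.eq_1, e12, List.range_succ, List.filter_append]
  by_cases hX : (flow ℓ r).X s (T (cen s) k) = 0
  · rw [Cmd.run_ite_zero (ev.trans hX)]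
    simp [Cmd.run, hout, hX]
  · rw [Cmd.run_ite_ne_zero (by rw [ev]; exact hX)]
    simp [Cmd.run, Exp.eval, hout, hX, h10]

theorem writeStars_run (hT : ∀ a < ℓ, ∀ b < ℓ, T a b < ℓ) (hcen : ∀ i, cen i < ℓ)
    (hL : Layout ℓ T cen r) {q : ℕ} (hq : q ≤ ℓ) (h6 : r.reg 6 = q) :
    (writeStars.run r).out = r.out ++
      (List.range q).flatMap fun s => cen s :: r.mem 6 s :: leafList ℓ T cen (flow ℓ r) s := by
  have := Cmd.run_loop_induction (c := .ite (.sub (.var 6) (.var 9))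
    (.seq (.write (.get 4 (.var 9))) <| .seq (.write (.get 6 (.var 9))) writeLeaves) .skip) (x := 9)
    (s := r) (by decide) (by decide)
    (fun k r' => Layout ℓ T cen r' ∧ r'.reg 6 = q ∧ r'.mem = r.mem ∧ r'.out = r.out ++
      (List.range (min k q)).flatMap
        fun s => cen s :: r.mem 6 s :: leafList ℓ T cen (flow ℓ r) s)
    ⟨hL.setReg (by decide), by simpa using h6, rfl, by simp⟩ ?_
  · rw [hL.len, min_eq_right hq] at this
    exact this.2.2.2
  rintro k hk r' - h9 ⟨hL', h6', hmem, hout⟩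
  rw [hL.len] at hk
  refine ⟨(hL'.run (by decide) (by decide)).setReg (by decide), ?_, ?_, ?_⟩
  · simp only [State.setReg_reg, Nat.reduceEqDiff, if_false]
    exact (Cmd.run_reg (by decide) r').trans h6'
  · ext a i
    rw [State.setReg_mem, Cmd.run_mem (by simp [Cmd.arrays, writeLeaves]), hmem]
  rw [State.setReg_out]
  by_cases hkq : k < q
  · rw [Cmd.run_ite_ne_zero (by simp only [Exp.eval, h6', h9]; omega), Cmd.run_seq, Cmd.run_seq,
      writeLeaves_run hT hcen ((hL'.run (c := .write (.get 4 (.var 9))) (by decide) (by decide)).run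
        (c := .write (.get 6 (.var 9))) (by decide) (by decide)) hk h9,
      min_eq_left (by omega), List.range_succ, List.flatMap_append]
    have hflow : flow ℓ ((Cmd.write (.get 6 (.var 9))).run ((Cmd.write (.get 4 (.var 9))).run r')) =
        flow ℓ r := by
      simp only [flow, Cmd.run, hmem]
    rw [hflow]
    rw [min_eq_left (by omega)] at hout
    have hcen' : r.mem 4 k = cen k := hL.cen k
    simp [Cmd.run, Exp.eval, hout, h9, hmem, hcen']
  · rw [Cmd.run_ite_zero (by simp only [Exp.eval, h6', h9]; omega)]
    rw [min_eq_right (by omega)] at hout ⊢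
    exact hout

/-- The stars are written if none of them lacks a unit, and otherwise `0` is. -/
theorem answer_run (hT : ∀ a < ℓ, ∀ b < ℓ, T a b < ℓ) (hcen : ∀ i, cen i < ℓ)
    (hL : Layout ℓ T cen r) {q : ℕ} (hq : q ≤ ℓ) (h6 : r.reg 6 = q) (hout : r.out = []) :
    ((∀ s ∈ Finset.range ℓ, (flow ℓ r).d s = 0) → (answer.run r).out = 1 :: q ::
      (List.range q).flatMap fun s => cen s :: r.mem 6 s :: leafList ℓ T cen (flow ℓ r) s) ∧
    ((¬ ∀ s ∈ Finset.range ℓ, (flow ℓ r).d s = 0) → (answer.run r).out = [0]) := by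
  have hcheck : (check.run r).reg 17 = 0 ↔ ∀ s ∈ Finset.range ℓ, (flow ℓ r).d s = 0 := by
    rw [check_run, hL.len]
    simp only [Finset.mem_range]
    rfl
  have hco : (check.run r).out = [] := (Cmd.run_out (by decide) r).trans hout
  rw [← hcheck, answer, Cmd.run_seq]
  constructor
  · intro h
    have hL' : Layout ℓ T cen (check.run r) := hL.run (by decide) (by decide)
    have hr6 : (check.run r).reg 6 = q := (Cmd.run_reg (by decide) r).trans h6
    have hmem : (check.run r).mem = r.mem := by
      ext a i
      rw [Cmd.run_mem (by simp [check, Cmd.arrays])]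
    rw [Cmd.run_ite_zero (by simpa only [Exp.eval] using h), Cmd.run_seq, Cmd.run_seq,
      writeStars_run hT hcen
      ((hL'.run (c := .write (.num 1)) (by decide) (by decide)).run
        (c := .write (.var 6)) (by decide) (by decide)) hq hr6]
    have hflow : flow ℓ ((Cmd.write (.var 6)).run ((Cmd.write (.num 1)).run (check.run r))) =
        flow ℓ r := by
      simp only [flow, Cmd.run, hmem]
    rw [hflow]
    simp [Cmd.run, Exp.eval, hco, hr6, hmem]
  · intro h
    rw [Cmd.run_ite_ne_zero (by simpa only [Exp.eval] using h)]
    simp [Cmd.run, Exp.eval, hco]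

/-! ### The encoding of an instance -/

/-- The multiplicities of an instance as a function on numbers. -/
def mu (I : Instance) (u v : ℕ) : ℕ :=
  if h : u < I.n ∧ v < I.n then I.graph.mult ⟨u, h.1⟩ ⟨v, h.2⟩ else 0

/-- The star sizes of an instance as a function on numbers. -/
def sz (I : Instance) (v : ℕ) : List ℕ :=
  if h : v < I.n then I.sizes ⟨v, h⟩ else []

theorem mu_val (I : Instance) (u v : Fin I.n) : mu I u v = I.graph.mult u v :=
  dif_pos ⟨u.2, v.2⟩

theorem sz_val (I : Instance) (v : Fin I.n) : sz I v = I.sizes v :=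
  dif_pos v.2

theorem encode_eq (I : Instance) :
    I.encode =
      I.n :: (pairRows I.n (mu I) (List.range I.n) ++ starRows (sz I) (List.range I.n)) := by
  simp only [Instance.encode, pairRows, starRows, ← List.map_coe_finRange_eq_range,
    List.flatMap_map, List.filter_map, List.map_map, sz_val]
  congr 3
  ext1 u
  refine List.map_congr_left fun v _ => (mu_val I u v).symm

theorem length_starRows (f : ℕ → List ℕ) (L : List ℕ) :
    (starRows f L).length = (starList f L).length + L.length := by
  induction L with
  | nil => rfl
  | cons v L ih =>
    simp only [starRows, starList, List.flatMap_cons, List.length_append, List.length_cons,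
      List.length_map] at *
    omega

theorem mem_starList {f : ℕ → List ℕ} {L : List ℕ} {p : ℕ × ℕ} :
    p ∈ starList f L ↔ p.1 ∈ L ∧ p.2 ∈ f p.1 := by
  obtain ⟨v, m⟩ := p
  simp only [starList, List.mem_flatMap, List.mem_map, Prod.mk.injEq]
  constructor
  · rintro ⟨u, hu, k, hk, rfl, rfl⟩
    exact ⟨hu, hk⟩
  · rintro ⟨hv, hm⟩
    exact ⟨v, hv, m, hm, rfl, rfl⟩

theorem map_snd_filter_starList (f : ℕ → List ℕ) {L : List ℕ} (hL : L.Nodup) {v : ℕ} (hv : v ∈ L) :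
    ((starList f L).filter fun p => p.1 = v).map Prod.snd = f v := by
  have hnot : ∀ L : List ℕ, v ∉ L → ((starList f L).filter fun p => p.1 = v) = [] := by
    intro L hv
    rw [List.filter_eq_nil_iff]
    intro p hp h
    rw [mem_starList] at hp
    exact hv (of_decide_eq_true h ▸ hp.1)
  induction L with
  | nil => cases hv
  | cons u L ih =>
    obtain ⟨hu, hL⟩ := List.nodup_cons.1 hL
    rw [starList, List.flatMap_cons, List.filter_append, List.map_append]
    by_cases huv : u = v
    · subst huv
      have h1 : ((f u).map fun m => (u, m)).filter (fun p => p.1 = u) =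
          (f u).map fun m => (u, m) := by
        rw [List.filter_eq_self]
        intro p hp
        obtain ⟨m, -, rfl⟩ := List.mem_map.1 hp
        simp
      have h2 := hnot L hu
      rw [starList] at h2
      rw [h1, h2, List.map_map]
      simp
    · have h1 : ((f u).map fun m => (u, m)).filter (fun p => p.1 = v) = [] := by
        rw [List.filter_eq_nil_iff]
        intro p hp
        obtain ⟨m, -, rfl⟩ := List.mem_map.1 hp
        simpa using huv
      rw [h1, List.map_nil, List.nil_append]
      exact ih hL ((List.mem_cons.1 hv).resolve_left (Ne.symm huv))

end Algorithm

/-! ### Correctness -/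

namespace Algorithm

/-- The state after the instance `I` has been read. -/
structure Loaded (I : Instance) (ℓ : ℕ) (r : State) : Prop where
  len : r.reg 0 = ℓ
  n_le : I.n ≤ ℓ
  pos : 0 < ℓ
  stars_le : r.reg 6 ≤ ℓ
  off : ∀ i < ℓ, r.mem 1 i = i * ℓ
  numbering : ∃ p, PairTable ℓ I.n (mu I) (fun u v => u < v ∧ v < I.n) p (table ℓ r) (r.mem 3)
  stars : HoldsStars r (starList (sz I) (List.range I.n))
  assignment : ∀ i, r.mem 7 i = 0
  height : ∀ i, r.mem 8 i = 0
  out : r.out = []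

theorem read_run (I : Instance) : ∃ r, Loaded I I.encode.length r ∧
    algorithm.run (State.init I.encode) = answer.run (sweeps.run r) := by
  set w := I.encode with hw
  have hlen : w.length = 1 + ((pairRows I.n (mu I) (List.range I.n)).length +
      ((starList (sz I) (List.range I.n)).length + I.n)) := by
    rw [hw, encode_eq, List.length_cons, List.length_append, length_starRows, List.length_range]
    ring
  have h0 : ∀ a ≠ 0, ∀ i, (State.init w).mem a i = 0 := fun a ha i => by simp [State.init, ha]
  have hin : ∀ i, (State.init w).mem 0 i = w.getD i 0 := fun i => by simp [State.init]
  have hl0 : (State.init w).reg 0 = w.length := by simp [State.init]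
  set r₁ := offsets.run (State.init w) with hr₁
  have hl1 : r₁.reg 0 = w.length := (Cmd.run_reg (by decide) _).trans hl0
  have hm1 : ∀ a ≠ 1, r₁.mem a = (State.init w).mem a := fun a ha =>
    Cmd.run_mem (by simpa [offsets, Cmd.arrays] using ha) _
  have hoff1 : ∀ i < w.length, r₁.mem 1 i = i * w.length := by
    rw [← hl0]
    exact offsets_run _
  set r₂ := readPairs.run r₁ with hr₂
  obtain ⟨hn2, hdrop2, hpairs⟩ := readPairs_run (s := r₁) (n := I.n) (μ := mu I)
    (rest := starRows (sz I) (List.range I.n)) hl1 (by rw [hm1 0 (by decide)]; exact hin) hoff1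
    (by rw [hm1 2 (by decide)]; exact h0 2 (by decide))
    (by rw [hm1 3 (by decide)]; exact h0 3 (by decide)) (encode_eq I) (by omega)
  have hl2 : r₂.reg 0 = w.length := (Cmd.run_reg (by decide) _).trans hl1
  have hm2 : ∀ a, a ≠ 2 → a ≠ 3 → r₂.mem a = r₁.mem a := fun a h2 h3 =>
    Cmd.run_mem (by simp [readPairs, readPair, Cmd.arrays, h2, h3]) _
  have hz2 : ∀ a, 4 ≤ a → ∀ i, r₂.mem a i = 0 := fun a ha i => by
    rw [hm2 a (by omega) (by omega), hm1 a (by omega), h0 a (by omega)]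
  set r₃ := readStars.run r₂ with hr₃
  have hstars : HoldsStars r₃ (starList (sz I) (List.range I.n)) :=
    readStars_run hl2 (by rw [hm2 0 (by decide) (by decide), hm1 0 (by decide)]; exact hin) hn2
      (hz2 4 (by decide)) (hz2 5 (by decide)) (hz2 6 (by decide)) hdrop2 (by omega)
  have hm3 : ∀ a, a ≠ 4 → a ≠ 5 → a ≠ 6 → r₃.mem a = r₂.mem a := fun a h4 h5 h6 =>
    Cmd.run_mem (by simp [readStars, readStar, Cmd.arrays, h4, h5, h6]) _
  refine ⟨r₃, ⟨(Cmd.run_reg (by decide) _).trans hl2, by omega, by omega, ?_, ?_, ?_, hstars,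
    ?_, ?_, ?_⟩, rfl⟩
  · have := congrArg List.length hstars.eq
    rw [List.length_map, List.length_range] at this
    omega
  · rw [hm3 1 (by decide) (by decide) (by decide), hm2 1 (by decide) (by decide)]
    exact hoff1
  · have ht : table w.length r₃ = table w.length r₂ := by
      ext u v
      rw [table, table, hm3 2 (by decide) (by decide) (by decide)]
    rw [ht, hm3 3 (by decide) (by decide) (by decide)]
    exact ⟨_, hpairs⟩
  · rw [hm3 7 (by decide) (by decide) (by decide)]
    exact hz2 7 (by decide)
  · rw [hm3 8 (by decide) (by decide) (by decide)]
    exact hz2 8 (by decide)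
  · rw [hr₃, Cmd.run_out (by decide), hr₂, Cmd.run_out (by decide), hr₁, Cmd.run_out (by decide)]
    rfl

namespace Loaded

variable {I : Instance} {ℓ : ℕ} {r : State}

theorem pairs (h : Loaded I ℓ r) : PairTable ℓ I.n (mu I) (fun u v => u < v ∧ v < I.n)
    h.numbering.choose (table ℓ r) (r.mem 3) :=
  h.numbering.choose_spec

theorem entry_mem (h : Loaded I ℓ r) {k : ℕ} (hk : k < r.reg 6) :
    r.mem 4 k < I.n ∧ r.mem 6 k ∈ sz I (r.mem 4 k) := by
  have : (r.mem 4 k, r.mem 6 k) ∈ starList (sz I) (List.range I.n) := by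
    rw [← h.stars.eq]
    exact List.mem_map.2 ⟨k, List.mem_range.2 hk, rfl⟩
  rw [mem_starList, List.mem_range] at this
  exact this

theorem centre_lt (h : Loaded I ℓ r) (i : ℕ) : r.mem 4 i < ℓ := by
  rcases lt_or_ge i (r.reg 6) with hi | hi
  · exact (h.entry_mem hi).1.trans_le h.n_le
  · rw [(h.stars.zero i hi).1]
    exact h.pos

theorem table_lt (h : Loaded I ℓ r) : ∀ a < ℓ, ∀ b < ℓ, table ℓ r a b < ℓ := by
  intro a ha b hb
  by_cases h1 : a < b ∧ b < I.n
  · exact (h.pairs.bound a b h1).2.2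
  · by_cases h2 : b < a ∧ a < I.n
    · rw [h.pairs.symm b a h2]
      exact (h.pairs.bound b a h2).2.2
    · rw [h.pairs.off a ha b hb h1 h2]
      exact h.pos

theorem table_comm (h : Loaded I ℓ r) {u v : ℕ} (hu : u < I.n) (hv : v < I.n) :
    table ℓ r u v = table ℓ r v u := by
  rcases lt_trichotomy u v with huv | rfl | huv
  · exact (h.pairs.symm u v ⟨huv, hv⟩).symm
  · rfl
  · exact h.pairs.symm v u ⟨huv, hu⟩

theorem layout (h : Loaded I ℓ r) : Layout ℓ (table ℓ r) (r.mem 4) r :=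
  ⟨h.len, h.off, fun _ _ => rfl, fun _ => rfl⟩

/-- The number of a pair of vertices; loops `s(u, u)` get the number `0`. -/
def pid (h : Loaded I ℓ r) : Sym2 (Fin I.n) → ℕ :=
  Sym2.lift ⟨fun u v => table ℓ r u v, fun u v => h.table_comm u.2 v.2⟩

/-- The centre of a star. -/
def centre (h : Loaded I ℓ r) (k : Fin (r.reg 6)) : Fin I.n := ⟨r.mem 4 k, (h.entry_mem k.2).1⟩

theorem exists_lt_of_not_isDiag {n : ℕ} (z : Sym2 (Fin n)) (hz : ¬ z.IsDiag) :
    ∃ u v : Fin n, u < v ∧ z = s(u, v) := by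
  induction z using Sym2.ind with
  | _ u v =>
    rcases lt_trichotomy u v with h | rfl | h
    · exact ⟨u, v, h, rfl⟩
    · exact absurd rfl hz
    · exact ⟨v, u, h, Sym2.eq_swap⟩

theorem isEncoding (h : Loaded I ℓ r) :
    IsEncoding I.graph I.starSizes (Finset.range ℓ) (Finset.range ℓ)
      (Incident ℓ (table ℓ r) (r.mem 4)) (r.mem 5) (r.mem 3) (fun k : Fin (r.reg 6) => (k : ℕ))
      h.centre h.pid where
  g_mem k := Finset.mem_range.2 (k.2.trans_le h.stars_le)
  g_inj := Fin.val_injective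
  pos k := by
    have h1 := (h.entry_mem k.2).2
    rw [h.stars.need]
    exact I.pos (h.centre k) _ (by rw [← sz_val]; exact h1)
  exists_of_ne_zero s _ hs := by
    rcases lt_or_ge s (r.reg 6) with hlt | hge
    · exact ⟨⟨s, hlt⟩, rfl⟩
    · rw [h.stars.need, (h.stars.zero s hge).2] at hs
      exact absurd rfl hs
  sizes v := by
    have h1 := map_snd_filter_starList (sz I) List.nodup_range (List.mem_range.2 v.2)
    rw [← h.stars.eq, ← List.map_coe_finRange_eq_range, List.map_map, List.filter_map,
      List.map_map, sz_val] at h1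
    rw [Instance.starSizes, ← h1, h.stars.need, Finset.filter_val]
    change Multiset.map _ (Multiset.filter _ (Multiset.ofList (List.finRange (r.reg 6)))) = _
    rw [Multiset.filter_coe, Multiset.map_coe]
    congr 2
    refine List.filter_congr fun k _ => ?_
    simp [centre, Fin.ext_iff]
  pid_mem z _ := by
    induction z using Sym2.ind with
    | _ u v =>
      exact Finset.mem_range.2 (h.table_lt _ (u.2.trans_le h.n_le) _ (v.2.trans_le h.n_le))
  pid_inj z z' hz hz' heq := by
    obtain ⟨u, v, huv, rfl⟩ := exists_lt_of_not_isDiag z hz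
    obtain ⟨u', v', huv', rfl⟩ := exists_lt_of_not_isDiag z' hz'
    obtain ⟨h1, h2⟩ := h.pairs.inj u v u' v' ⟨huv, v.2⟩ ⟨huv', v'.2⟩ heq
    rw [Fin.ext h1, Fin.ext h2]
  cap_pid u v huv := by
    rcases lt_or_gt_of_ne huv with hlt | hlt
    · rw [← mu_val]
      exact h.pairs.mult u v ⟨hlt, v.2⟩
    · rw [Sym2.eq_swap, I.graph.symm, ← mu_val]
      exact h.pairs.mult v u ⟨hlt, u.2⟩
  inc_pid k w _ := ⟨w, w.2.trans_le h.n_le, rfl⟩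
  eq_pid_of_inc k e _ := by
    rintro ⟨w, hw, rfl⟩ hcap
    have hk := (h.centre k).2
    have hD : ¬ (¬ (r.mem 4 k < w ∧ w < I.n) ∧ ¬ (w < r.mem 4 k ∧ r.mem 4 k < I.n)) := by
      rintro ⟨h1, h2⟩
      rw [h.pairs.off _ (h.centre_lt k) w hw h1 h2, h.pairs.zero] at hcap
      exact hcap rfl
    change r.mem 4 k < I.n at hk
    refine ⟨⟨w, by omega⟩, fun heq => ?_, rfl⟩
    have : r.mem 4 k = w := congrArg Fin.val heq
    omega

theorem progress (h : Loaded I ℓ r) :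
    Progress ℓ (table ℓ r) (r.mem 4) (r.mem 5) (r.mem 3) 0 r := by
  have : flow ℓ r = Flow.empty (r.mem 5) (r.mem 3) := by
    ext i j <;> simp [flow, Flow.empty, h.assignment, h.height]
  refine ⟨h.layout, ?_, Or.inr (Nat.zero_le _)⟩
  rw [this]
  exact Flow.valid_empty

end Loaded

/-- The leaves in increasing order are those met in a search through all numbers below `ℓ`. -/
theorem map_val_sort_eq {n ℓ : ℕ} (hn : n ≤ ℓ) (L : Finset (Fin n)) (p : ℕ → Bool)
    (hp : ∀ w < ℓ, p w = true ↔ ∃ h : w < n, (⟨w, h⟩ : Fin n) ∈ L) :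
    (L.sort (· ≤ ·)).map (fun v : Fin n => (v : ℕ)) = (List.range ℓ).filter p := by
  refine List.Pairwise.eq_of_mem_iff (r := (· < ·)) ?_ ?_ fun w => ?_
  · rw [List.pairwise_map]
    exact (Finset.sortedLT_sort L).pairwise
  · exact List.pairwise_lt_range.filter _
  · simp only [List.mem_map, Finset.mem_sort, List.mem_filter, List.mem_range]
    constructor
    · rintro ⟨v, hv, rfl⟩
      have := v.2.trans_le hn
      exact ⟨this, (hp v this).2 ⟨v.2, hv⟩⟩
    · rintro ⟨hw, h⟩
      obtain ⟨h, hL⟩ := (hp w hw).1 h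
      exact ⟨⟨w, h⟩, hL, rfl⟩

/-- The coercion of a list of vertices inside `encodeStars` is a monadic lift. -/
theorem map_bind_pure_val {n : ℕ} (l : List (Fin n)) :
    ((do let a ← l; pure (a : ℕ)) : List ℕ).map (fun v => v) = l.map fun v : Fin n => (v : ℕ) := by
  induction l with
  | nil => rfl
  | cons a l ih => simpa using ih

/-- The output is a packing if there is one, and `0` otherwise. -/
theorem algorithm_correct (I : Instance) :
    ((∃ P : Multiset (CentredStar (Fin I.n)), IsStarPacking I.graph I.starSizes P) →
      ∃ P : List (CentredStar (Fin I.n)), IsStarPacking I.graph I.starSizes (P : Multiset _) ∧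
        (algorithm.run (State.init I.encode)).out = 1 :: encodeStars P) ∧
    ((¬ ∃ P : Multiset (CentredStar (Fin I.n)), IsStarPacking I.graph I.starSizes P) →
      (algorithm.run (State.init I.encode)).out = [0]) := by
  obtain ⟨r, h, hrun⟩ := read_run I
  rw [hrun]
  set ℓ := I.encode.length
  have henc := h.isEncoding
  obtain ⟨hv, hst⟩ := sweeps_run h.table_lt h.centre_lt h.progress
  have hL : Layout ℓ (table ℓ r) (r.mem 4) (sweeps.run r) := h.layout.run (by decide) (by decide)
  have h6 : (sweeps.run r).reg 6 = r.reg 6 := Cmd.run_reg (by decide) r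
  have hm6 : (sweeps.run r).mem 6 = r.mem 6 := Cmd.run_mem (by decide) r
  obtain ⟨hyes, hno⟩ := answer_run h.table_lt h.centre_lt hL h.stars_le h6
    ((Cmd.run_out (by decide) r).trans h.out)
  by_cases hd : ∀ s ∈ Finset.range ℓ, (flow ℓ (sweeps.run r)).d s = 0
  · have hpack := henc.isStarPacking hv hd
    refine ⟨fun _ => ⟨(List.finRange (r.reg 6)).map (henc.star hv hd), hpack, ?_⟩,
      fun hnot => absurd ⟨_, hpack⟩ hnot⟩
    rw [hyes hd, encodeStars, List.length_map, List.length_finRange, List.flatMap_map,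
      ← List.map_coe_finRange_eq_range, List.flatMap_map]
    congr 3
    ext1 k
    have hkℓ := k.2.trans_le h.stars_le
    congr 1
    congr 1
    · rw [hm6, ← h.stars.need, ← hv.demand k (Finset.mem_range.2 hkℓ),
        hd k (Finset.mem_range.2 hkℓ), zero_add]
      exact (henc.card_leafSet hv k).symm
    · rw [map_bind_pure_val]
      refine (map_val_sort_eq h.n_le _ _ fun w hw => ?_).symm
      rw [decide_eq_true_eq]
      constructor
      · intro hX
        have hcap : r.mem 3 (table ℓ r (r.mem 4 k) w) ≠ 0 := by
          have hE := Finset.mem_range.2 (h.table_lt _ (h.centre_lt k) w hw)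
          rw [← hv.capacity _ hE]
          have := Finset.single_le_sum
            (f := fun s => (flow ℓ (sweeps.run r)).X s (table ℓ r (r.mem 4 k) w))
            (fun _ _ => Nat.zero_le _) (Finset.mem_range.2 hkℓ)
          omega
        have hk : r.mem 4 k < I.n := (h.centre k).2
        have hD : ¬ (¬ (r.mem 4 k < w ∧ w < I.n) ∧ ¬ (w < r.mem 4 k ∧ r.mem 4 k < I.n)) := by
          rintro ⟨h1, h2⟩
          rw [h.pairs.off _ (h.centre_lt k) w hw h1 h2, h.pairs.zero] at hcap
          exact hcap rfl
        refine ⟨by omega, Finset.mem_filter.2 ⟨Finset.mem_univ _, fun heq => ?_, hX⟩⟩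
        have : r.mem 4 k = w := congrArg Fin.val heq
        omega
      · rintro ⟨hwn, hmem⟩
        exact (Finset.mem_filter.1 hmem).2.2
  · have hnone : ¬ ∃ P : Multiset (CentredStar (Fin I.n)),
        IsStarPacking I.graph I.starSizes P := by
      rintro ⟨P, hP⟩
      push Not at hd
      obtain ⟨s₀, hs₀, hd⟩ := hd
      obtain ⟨f, hf, hlt⟩ := henc.exists_lt_sum_sigma_of_stuck hv (by simp) hst hs₀ hd
      exact absurd (hP.sum_sigma_le hf) (not_le.2 hlt)
    exact ⟨fun hP => absurd hP hnone, fun _ => hno hd⟩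

end Algorithm

end StarPacking

theorem theorem2 :
    (∀ (V : Type*) [Fintype V] [DecidableEq V] (G : StarPacking.Multigraph V)
        (M : V → Multiset ℕ), (∀ v, ∀ m ∈ M v, 0 < m) →
      ((∃ P : Multiset (StarPacking.CentredStar V), StarPacking.IsStarPacking G M P) ↔
        ∀ f : V → ℕ, (∀ v, f v ≤ (M v).card) →
          ∑ v, StarPacking.sigma (f v) (M v) ≤
            ∑ e : Sym2 V with ¬ e.IsDiag, G.cappedMult f e)) ∧
    ∃ (p : StarPacking.Program) (T : Polynomial ℕ), ∀ I : StarPacking.Instance,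
      ∃ (t : ℕ) (s : StarPacking.State),
        StarPacking.Exec p (StarPacking.State.init I.encode) t s ∧
        t ≤ T.eval (StarPacking.binarySize I.encode) ∧
        ((∃ P : Multiset (StarPacking.CentredStar (Fin I.n)),
            StarPacking.IsStarPacking I.graph I.starSizes P) →
          ∃ P : List (StarPacking.CentredStar (Fin I.n)),
            StarPacking.IsStarPacking I.graph I.starSizes (P : Multiset _) ∧
            s.out = 1 :: StarPacking.encodeStars P) ∧
        ((¬ ∃ P : Multiset (StarPacking.CentredStar (Fin I.n)),
            StarPacking.IsStarPacking I.graph I.starSizes P) →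
          s.out = [0]) := by
  refine ⟨fun V _ _ G M hpos => ⟨fun ⟨P, hP⟩ f hf => hP.sum_sigma_le hf,
    StarPacking.exists_isStarPacking hpos⟩,
    StarPacking.Algorithm.algorithm.compile, StarPacking.Algorithm.algorithm.time, fun I => ?_⟩
  obtain ⟨t, s, hexec, ht, hout⟩ :=
    StarPacking.Cmd.exists_exec_compile (c := StarPacking.Algorithm.algorithm) (by decide) I.encode
  refine ⟨t, s, hexec, ht, ?_⟩
  rw [hout]
  exact StarPacking.Algorithm.algorithm_correct I
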